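/- Let $d$ be a nonnegative integer and $\alpha>-1/2$. Write $\mathbb R^{d+1}_+=\mathbb R^d\times(0,\infty)$, $x=(x',x_{d+1})$, $-x=(-x',x_{d+1})$, and $$d\mu_\alpha(x)=\frac{x_{d+1}^{2\alpha+1}}{(2\pi)^{d/2}\,2^{\alpha}\,\Gamma(\alpha+1)}\,dx,\qquad j_\alpha(t)=\Gamma(\alpha+1)\sum_{k\ge 0}\frac{(-1)^k t^{2k}}{2^{2k}\,k!\,\Gamma(\alpha+k+1)},\qquad \Lambda(\lambda,x)=e^{-i\langle x',\lambda'\rangle}j_\alpha(x_{d+1}\lambda_{d+1}).$$ Let $L^p_\alpha$ be the space of complex-valued $L^p$ functions on $(\mathbb R^{d+1}_+,\mu_\alpha)$, with norm $\|\cdot\|_{\alpha,p}$. The Weinstein transform is $\mathcal F(\varphi)(\lambda)=\int\varphi(x)\Lambda(\lambda,x)\,d\mu_\alpha(x)$ on $L^1_\alpha$, extended by continuity from $L^1_\alpha\cap L^2_\alpha$ to $L^2_\alpha$; for $g\in L^1_\alpha$ put $\mathcal F^{-1}(g)(\lambda)=\mathcal F(g)(-\lambda)$. For $m,\varphi\in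 L^2_\alpha$ and $\sigma>0$ let $m_\sigma(x)=m(\sigma x)$ and $\mathcal T_{m,\sigma}\varphi=\mathcal F^{-1}(m_\sigma\mathcal F(\varphi))$. Let $d\Theta_\alpha(\sigma,x)=\frac{d\sigma}{\sigma}\,d\mu_\alpha(x)$ on $(0,\infty)\times\mathbb R^{d+1}_+$. Let $m\in L^1_\alpha\cap L^2_\alpha$ be admissible, that is, $\int_0^\infty|m(\sigma x)|^2\frac{d\sigma}{\sigma}=1$ for almost every $x\in\mathbb R^{d+1}_+$, and let $\varphi\in L^2_\alpha$, $\varphi\ne 0$. Let $\Omega\subseteq\mathbb R^{d+1}_+$ be measurable, $\varepsilon,\nu\in\mathbb R$ and $\varrho>0$. Suppose that $\varphi$ is $\varepsilon$-concentrated on $\Omega$, that is, $\|\varphi-\chi_\Omega\varphi\|_{\alpha,2}\le\varepsilon\|\varphi\|_{\alpha,2}$. If $$\Sigma=\{(\sigma,x)\in(0,\infty)\times\mathbb R^{d+1}_+:\sigma\ge\varrho\},\qquad \rho=\max\{1/\sigma:(\sigma,x)\in\Sigma\text{ for some }x\in\mathbb R^{d+1}_+\},$$ and if $\mathcal T_{m,\sigma}\varphi$,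 as a function $F(\sigma,x)=\mathcal T_{m,\sigma}\varphi(x)$, is $\nu$-concentrated on $\Sigma$, that is, $\|F-\chi_\Sigma F\|_{L^2(\Theta_\alpha)}\le\nu\|F\|_{L^2(\Theta_\alpha)}$, then $$\rho^{2\alpha+d+2}\,\|m\|_{\alpha,1}\,\mu_\alpha(\Omega)^{1/2}\,\Theta_\alpha(\Sigma)^{1/2}\ \ge\ 1-(\varepsilon+\nu),$$ where the left side is taken in $[0,\infty]$ with $0\cdot\infty=0$. The same holds, more generally, if $\Sigma$ is any nonempty measurable subset of $\{(\sigma,x)\in(0,\infty)\times\mathbb R^{d+1}_+:\sigma\ge\varrho\}$ and $\rho=\sup\{1/\sigma:(\sigma,x)\in\Sigma\text{ for some }x\in\mathbb R^{d+1}_+\}$. -/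

import Mathlib

open MeasureTheory Set Filter Topology
open scoped ENNReal

noncomputable section

namespace Weinstein

/-- The ambient space `ℝ^d × ℝ` of points `x = (x', x_{d+1})`. -/
abbrev Space (d : ℕ) : Type := EuclideanSpace ℝ (Fin d) × ℝ

/-- The open half-space `ℝ^d × (0, ∞)`. -/
def halfSpace (d : ℕ) : Set (Space d) := {x | 0 < x.2}

/-- The Weinstein measure
`dμ_α(x) = x_{d+1}^(2α+1) / ((2π)^(d/2) 2^α Γ(α+1)) dx` on the half-space, seen as a measure on
`ℝ^d × ℝ` carried by the half-space. With this constant the Weinstein transform is an isometry. -/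
def measure (d : ℕ) (α : ℝ) : Measure (Space d) :=
  (volume.restrict (halfSpace d)).withDensity fun x =>
    ENNReal.ofReal
      (x.2 ^ (2 * α + 1) / ((2 * Real.pi) ^ ((d : ℝ) / 2) * 2 ^ α * Real.Gamma (α + 1)))

/-- The normalized Bessel function
`j_α(t) = Γ(α+1) ∑_k (-1)^k t^(2k) / (2^(2k) k! Γ(α+k+1))`. -/
def besselJ (α t : ℝ) : ℝ :=
  Real.Gamma (α + 1) *
    ∑' k : ℕ, (-1) ^ k * t ^ (2 * k) / (2 ^ (2 * k) * (k.factorial : ℝ) * Real.Gamma (α + k + 1))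

/-- The Weinstein kernel `Λ(y, x) = exp(-i ⟨x', y'⟩) j_α(x_{d+1} y_{d+1})`. -/
def kernel {d : ℕ} (α : ℝ) (y x : Space d) : ℂ :=
  Complex.exp (-Complex.I * ((inner ℝ x.1 y.1 : ℝ) : ℂ)) * ((besselJ α (x.2 * y.2) : ℝ) : ℂ)

/-- The reflection `-x = (-x', x_{d+1})`. -/
def reflect {d : ℕ} (x : Space d) : Space d := (-x.1, x.2)

/-- The Weinstein transform of an integrable function, `y ↦ ∫ φ(x) Λ(y, x) dμ_α(x)`. -/
def transform {d : ℕ} (α : ℝ) (φ : Space d → ℂ) (y : Space d) : ℂ :=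
  ∫ x, φ x * kernel α y x ∂(measure d α)

/-- The inverse transform of an integrable function: the Weinstein transform at `-y`. -/
def inverseTransform {d : ℕ} (α : ℝ) (g : Space d → ℂ) (y : Space d) : ℂ :=
  transform α g (reflect y)

/-- `g` is (a representative of) the value at `φ ∈ L²` of the continuous extension of the Weinstein
transform from `L¹ ∩ L²` to `L²`: some sequence in `L¹ ∩ L²` tends to `φ` in `L²` while its
Weinstein transforms tend to `g` in `L²`. -/
def IsL2Transform {d : ℕ} (α : ℝ) (φ g : Space d → ℂ) : Prop :=
  MemLp g 2 (measure d α) ∧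
    ∃ u : ℕ → Space d → ℂ,
      (∀ n, MemLp (u n) 1 (measure d α) ∧ MemLp (u n) 2 (measure d α)) ∧
      Tendsto (fun n => eLpNorm (u n - φ) 2 (measure d α)) atTop (𝓝 0) ∧
      Tendsto (fun n => eLpNorm (transform α (u n) - g) 2 (measure d α)) atTop (𝓝 0)

open Classical in
/-- The Weinstein (Plancherel) transform of a function in `L²`; it is determined up to equality
almost everywhere. -/
def l2Transform {d : ℕ} (α : ℝ) (φ : Space d → ℂ) : Space d → ℂ :=
  if h : ∃ g, IsL2Transform α φ g then h.choose else 0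

/-- The Weinstein `L²`-multiplier operator: the inverse Weinstein transform of
`z ↦ m(σ z) F(φ)(z)`, a product of two square-integrable functions (hence integrable)
when `m, φ ∈ L²` and `σ > 0`. -/
def multiplier {d : ℕ} (α : ℝ) (m : Space d → ℂ) (σ : ℝ) (φ : Space d → ℂ) : Space d → ℂ :=
  inverseTransform α fun z => m (σ • z) * l2Transform α φ z

/-- The admissibility condition `∫_0^∞ |m(σ x)|² dσ/σ = 1` for almost every `x`. -/
def Admissible {d : ℕ} (α : ℝ) (m : Space d → ℂ) : Prop :=
  ∀ᵐ x ∂(measure d α), ∫⁻ σ in Ioi (0 : ℝ), ‖m (σ • x)‖ₑ ^ 2 * ENNReal.ofReal (1 / σ) = 1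

/-- The measure `dΘ_α(σ, x) = (dσ/σ) dμ_α(x)` on `(0, ∞) × (ℝ^d × (0, ∞))`. -/
def scaleMeasure (d : ℕ) (α : ℝ) : Measure (ℝ × Space d) :=
  ((volume.restrict (Ioi (0 : ℝ))).withDensity fun σ => ENNReal.ofReal (1 / σ)).prod (measure d α)

/-- A square-integrable function `f` is `ε`-concentrated on `A`:
`‖f - χ_A f‖₂ ≤ ε ‖f‖₂`, the norms being those of `L²(μ)`. -/
def Concentrated {X : Type*} [MeasurableSpace X] (μ : Measure X) (f : X → ℂ) (A : Set X)
    (ε : ℝ) : Prop :=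
  (eLpNorm (f - A.indicator f) 2 μ).toReal ≤ ε * (eLpNorm f 2 μ).toReal

/-- The set of the `(σ, x)` with `σ ≥ a` and `x` in the half-space. -/
def scalesAbove (d : ℕ) (a : ℝ) : Set (ℝ × Space d) := {p | a ≤ p.1 ∧ p.2 ∈ halfSpace d}

/-- The set of the numbers `1/σ`, where `(σ, x) ∈ S` for some `x`. -/
def inverseScales {d : ℕ} (S : Set (ℝ × Space d)) : Set ℝ :=
  {r | ∃ (σ : ℝ) (x : Space d), (σ, x) ∈ S ∧ r = 1 / σ}

end Weinstein

end

noncomputable section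

namespace Weinstein

open ProbabilityTheory

instance isProbabilityMeasure_betaMeasure_half {α : ℝ} [hα : Fact (-(1 / 2) < α)] :
    IsProbabilityMeasure (betaMeasure (1 / 2) (α + 1 / 2)) :=
  isProbabilityMeasureBeta (by norm_num) (by linarith [hα.out])

lemma ae_betaMeasure_mem_Ioo (a b : ℝ) : ∀ᵐ r ∂betaMeasure a b, r ∈ Ioo (0 : ℝ) 1 := by
  rw [betaMeasure, ae_withDensity_iff (by unfold betaPDF; fun_prop)]
  refine ae_of_all _ fun r hr => ?_
  by_contra h
  apply hr
  rw [betaPDF_eq, if_neg (by exact h), ENNReal.ofReal_zero]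

lemma integral_pow_betaMeasure {a b : ℝ} (ha : 0 < a) (hb : 0 < b) (k : ℕ) :
    ∫ r, r ^ k ∂betaMeasure a b = beta (a + k) b / beta a b := by
  have hak : 0 < a + k := by positivity
  have h0 := beta_pos ha hb
  have h1 := beta_pos hak hb
  rw [integral_eq_lintegral_of_nonneg_ae
    ((ae_betaMeasure_mem_Ioo a b).mono fun r hr => pow_nonneg hr.1.le k) (by fun_prop)]
  rw [betaMeasure, lintegral_withDensity_eq_lintegral_mul _ (by unfold betaPDF; fun_prop)
    (by fun_prop)]
  have : ∀ r : ℝ, (betaPDF a b * fun r => ENNReal.ofReal (r ^ k)) r =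
      ENNReal.ofReal (beta (a + k) b / beta a b) * betaPDF (a + k) b r := by
    intro r
    simp only [Pi.mul_apply, betaPDF_eq]
    split_ifs with h
    · have hr := h.1
      have h1r : 0 < 1 - r := by linarith [h.2]
      rw [← ENNReal.ofReal_mul (by positivity), ← ENNReal.ofReal_mul (by positivity)]
      congr 1
      rw [show a + k - 1 = (a - 1) + k by ring, Real.rpow_add hr, Real.rpow_natCast]
      field_simp
    · simp
  simp_rw [this]
  rw [lintegral_const_mul _ (by unfold betaPDF; fun_prop), lintegral_betaPDF_eq_one hak hb, mul_one,
    ENNReal.toReal_ofReal (by positivity)]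

lemma Gamma_nat_add_half_div (k : ℕ) :
    Real.Gamma (1 / 2 + k) / Real.Gamma (1 / 2) = (2 * k).factorial / (2 ^ (2 * k) * k.factorial) := by
  have hp : Real.Gamma (1 / 2) ≠ 0 := (Real.Gamma_pos_of_pos (by norm_num)).ne'
  induction k with
  | zero => simp [div_self hp, -one_div]
  | succ k ih =>
    rw [Nat.cast_succ, ← add_assoc, Real.Gamma_add_one (by positivity), mul_div_assoc, ih,
      show 2 * (k + 1) = 2 * k + 1 + 1 by ring, Nat.factorial_succ, Nat.factorial_succ,
      Nat.factorial_succ]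
    push_cast
    field_simp
    ring

/-- The Poisson representation of the normalized Bessel function. -/
lemma besselJ_eq_integral {α : ℝ} (hα : -(1 / 2) < α) (t : ℝ) :
    besselJ α t = ∫ r, Real.cos (t * √r) ∂betaMeasure (1 / 2) (α + 1 / 2) := by
  have : Fact (-(1 / 2) < α) := ⟨hα⟩
  set P := betaMeasure (1 / 2) (α + 1 / 2)
  have hP := ae_betaMeasure_mem_Ioo (1 / 2) (α + 1 / 2)
  have hs : HasSum (fun k : ℕ => ∫ r, (-1) ^ k * (t * √r) ^ (2 * k) / (2 * k).factorial ∂P)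
      (∫ r, Real.cos (t * √r) ∂P) := by
    refine hasSum_integral_of_dominated_convergence
      (fun k _ => |t| ^ (2 * k) / (2 * k).factorial) (fun k => by fun_prop) (fun k => ?_)
      (ae_of_all _ fun _ => ?_) (integrable_const _)
      (ae_of_all _ fun r => Real.hasSum_cos _)
    · filter_upwards [hP] with r hr
      have h1 : √r ≤ 1 := Real.sqrt_le_one.2 hr.2.le
      simp only [norm_div, norm_mul, norm_pow, norm_neg, norm_one, one_pow, one_mul,
        Real.norm_eq_abs, abs_of_nonneg (Real.sqrt_nonneg r), Nat.abs_cast]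
      gcongr
      exact mul_le_of_le_one_right (abs_nonneg t) h1
    · exact (Real.summable_pow_div_factorial |t|).comp_injective
        (i := fun k : ℕ => 2 * k) (mul_right_injective₀ two_ne_zero)
  rw [← hs.tsum_eq, besselJ, ← tsum_mul_left]
  refine tsum_congr fun k => ?_
  have hk : ∫ r, (-1) ^ k * (t * √r) ^ (2 * k) / (2 * k).factorial ∂P =
      ∫ r, ((-1) ^ k * t ^ (2 * k) / (2 * k).factorial) * r ^ k ∂P := by
    refine integral_congr_ae ?_
    filter_upwards [hP] with r hr
    rw [mul_pow, pow_mul (√r), Real.sq_sqrt hr.1.le]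
    ring
  have hb : 0 < α + 1 / 2 := by linarith
  rw [hk, integral_const_mul, integral_pow_betaMeasure (by norm_num) hb]
  have hG := Gamma_nat_add_half_div k
  have g1 : Real.Gamma (1 / 2) ≠ 0 := (Real.Gamma_pos_of_pos (by norm_num)).ne'
  have g2 : Real.Gamma (α + 1 / 2) ≠ 0 := (Real.Gamma_pos_of_pos hb).ne'
  have g3 : Real.Gamma (α + 1) ≠ 0 := (Real.Gamma_pos_of_pos (by linarith)).ne'
  have g4 : Real.Gamma (α + k + 1) ≠ 0 :=
    (Real.Gamma_pos_of_pos (by linarith [(Nat.cast_nonneg k : (0 : ℝ) ≤ k)])).ne'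
  rw [div_eq_iff g1] at hG
  rw [beta, beta, show 1 / 2 + (k : ℝ) + (α + 1 / 2) = α + k + 1 by ring,
    show 1 / 2 + (α + 1 / 2) = α + 1 by ring, hG]
  generalize Real.Gamma (α + 1 / 2) = c at *
  field_simp

lemma abs_besselJ_le_one {α : ℝ} (hα : -(1 / 2) < α) (t : ℝ) : |besselJ α t| ≤ 1 := by
  have : Fact (-(1 / 2) < α) := ⟨hα⟩
  rw [besselJ_eq_integral hα]
  have h := norm_integral_le_of_norm_le_const (μ := betaMeasure (1 / 2) (α + 1 / 2))
    (f := fun r => Real.cos (t * √r)) (C := 1)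
    (ae_of_all _ fun r => Real.abs_cos_le_one (t * √r))
  simpa only [Real.norm_eq_abs, probReal_univ, mul_one] using h

lemma continuous_besselJ {α : ℝ} (hα : -(1 / 2) < α) : Continuous (besselJ α) := by
  have : Fact (-(1 / 2) < α) := ⟨hα⟩
  rw [funext (besselJ_eq_integral hα)]
  refine continuous_of_dominated (bound := fun _ => 1) (fun t => by fun_prop)
    (fun t => ae_of_all _ fun r => Real.abs_cos_le_one _) (integrable_const _)
    (ae_of_all _ fun r => by fun_prop)

/-- The last factor of the Weinstein measure, carried by `(0, ∞)`. -/
def radialMeasure (α : ℝ) : Measure ℝ :=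
  (volume.restrict (Ioi (0 : ℝ))).withDensity fun x =>
    ENNReal.ofReal (x ^ (2 * α + 1) / (2 ^ α * Real.Gamma (α + 1)))

instance sigmaFinite_radialMeasure (α : ℝ) : SigmaFinite (radialMeasure α) := by
  unfold radialMeasure; infer_instance

instance sigmaFinite_measure (d : ℕ) (α : ℝ) : SigmaFinite (measure d α) := by
  unfold measure; infer_instance

lemma measurableSet_halfSpace (d : ℕ) : MeasurableSet (halfSpace d) :=
  measurableSet_lt measurable_const measurable_snd

lemma measure_eq_prod (d : ℕ) (α : ℝ) :
    measure d α = (ENNReal.ofReal (((2 * Real.pi) ^ ((d : ℝ) / 2))⁻¹) •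
      (volume : Measure (EuclideanSpace ℝ (Fin d)))).prod (radialMeasure α) := by
  have h : halfSpace d = univ ×ˢ Ioi (0 : ℝ) := by ext x; simp [halfSpace]
  rw [Measure.prod_smul_left, radialMeasure, prod_withDensity_right (by fun_prop), measure, h,
    Measure.volume_eq_prod, ← Measure.prod_restrict, Measure.restrict_univ,
    ← withDensity_smul _ (by fun_prop)]
  congr 1
  ext x
  rw [Pi.smul_apply, smul_eq_mul, ← ENNReal.ofReal_mul (by positivity)]
  congr 1
  rw [mul_assoc, div_mul_eq_div_div_swap]
  ring

lemma ae_measure_mem_halfSpace (d : ℕ) (α : ℝ) : ∀ᵐ x ∂measure d α, x ∈ halfSpace d :=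
  (withDensity_absolutelyContinuous _ _) (ae_restrict_mem (measurableSet_halfSpace d))

lemma integral_radialMeasure {E : Type*} [NormedAddCommGroup E] [NormedSpace ℝ E] {α : ℝ}
    (hα : -1 < α) (f : ℝ → E) :
    ∫ x, f x ∂radialMeasure α =
      ∫ x in Ioi (0 : ℝ), (x ^ (2 * α + 1) / (2 ^ α * Real.Gamma (α + 1))) • f x := by
  have := Real.Gamma_pos_of_pos (show 0 < α + 1 by linarith)
  rw [radialMeasure, integral_withDensity_eq_integral_toReal_smul (by fun_prop)
    (ae_of_all _ fun _ => ENNReal.ofReal_lt_top)]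
  refine setIntegral_congr_fun measurableSet_Ioi fun x hx => ?_
  have hx : (0 : ℝ) < x := hx
  rw [ENNReal.toReal_ofReal (by positivity)]

lemma integrable_radialMeasure_iff {E : Type*} [NormedAddCommGroup E] [NormedSpace ℝ E] {α : ℝ}
    (hα : -1 < α) {f : ℝ → E} :
    Integrable f (radialMeasure α) ↔
      IntegrableOn (fun x => (x ^ (2 * α + 1) / (2 ^ α * Real.Gamma (α + 1))) • f x)
        (Ioi (0 : ℝ)) := by
  have := Real.Gamma_pos_of_pos (show 0 < α + 1 by linarith)
  rw [radialMeasure, integrable_withDensity_iff_integrable_smul' (by fun_prop)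
    (ae_of_all _ fun _ => ENNReal.ofReal_lt_top)]
  refine integrableOn_congr_fun (fun x hx => ?_) measurableSet_Ioi
  have hx : (0 : ℝ) < x := hx
  rw [ENNReal.toReal_ofReal (by positivity)]

lemma integrable_exp_radialMeasure {α : ℝ} (hα : -1 < α) {s : ℝ} (hs : 0 < s) :
    Integrable (fun x => Real.exp (s * (-x ^ 2 / 2))) (radialMeasure α) := by
  rw [integrable_radialMeasure_iff hα]
  have := (integrableOn_rpow_mul_exp_neg_mul_sq (half_pos hs)
    (show -1 < 2 * α + 1 by linarith)).const_mul (2 ^ α * Real.Gamma (α + 1))⁻¹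
  refine this.congr (ae_of_all _ fun x => ?_)
  simp only [smul_eq_mul]
  rw [show s * (-x ^ 2 / 2) = -(s / 2) * x ^ 2 by ring]
  ring

lemma integral_exp_radialMeasure {α : ℝ} (hα : -1 < α) {s : ℝ} (hs : 0 < s) :
    ∫ x, Real.exp (s * (-x ^ 2 / 2)) ∂radialMeasure α = s ^ (-(α + 1)) := by
  have hG := Real.Gamma_pos_of_pos (show 0 < α + 1 by linarith)
  have h := integral_rpow_mul_exp_neg_mul_rpow two_pos (show -1 < 2 * α + 1 by linarith)
    (half_pos hs)
  rw [integral_radialMeasure hα]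
  have h' : ∀ x : ℝ, (x ^ (2 * α + 1) / (2 ^ α * Real.Gamma (α + 1))) •
      Real.exp (s * (-x ^ 2 / 2)) = (2 ^ α * Real.Gamma (α + 1))⁻¹ *
        (x ^ (2 * α + 1) * Real.exp (-(s / 2) * x ^ (2 : ℝ))) := by
    intro x
    rw [Real.rpow_two, show s * (-x ^ 2 / 2) = -(s / 2) * x ^ 2 by ring, smul_eq_mul]
    ring
  simp_rw [h']
  rw [integral_const_mul, h, show (2 * α + 1 + 1) / 2 = α + 1 by ring,
    show -(2 * α + 1 + 1) / 2 = -(α + 1) by ring, Real.div_rpow hs.le two_pos.le,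
    Real.rpow_neg two_pos.le, Real.rpow_add_one two_ne_zero]
  field_simp

lemma mem_interior_integrableExpSet {α : ℝ} (hα : -1 < α) {s : ℝ} (hs : 0 < s) :
    s ∈ interior (integrableExpSet (fun x : ℝ => -x ^ 2 / 2) (radialMeasure α)) :=
  interior_maximal (fun _ ht => integrable_exp_radialMeasure hα ht) isOpen_Ioi hs

lemma integrable_cexp_radialMeasure {α : ℝ} (hα : -1 < α) {z : ℂ} (hz : 0 < z.re) :
    Integrable (fun x : ℝ => Complex.exp (z * ((-x ^ 2 / 2 : ℝ) : ℂ))) (radialMeasure α) := by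
  rw [← integrable_norm_iff (by fun_prop)]
  simpa only [Complex.norm_exp, Complex.re_mul_ofReal] using integrable_exp_radialMeasure hα hz

lemma integral_cexp_radialMeasure {α : ℝ} (hα : -1 < α) {z : ℂ} (hz : 0 < z.re) :
    ∫ x, Complex.exp (z * ((-x ^ 2 / 2 : ℝ) : ℂ)) ∂radialMeasure α = z ^ (-((α : ℂ) + 1)) := by
  have h1 : AnalyticOnNhd ℂ (complexMGF (fun x : ℝ => -x ^ 2 / 2) (radialMeasure α))
      {z | 0 < z.re} :=
    analyticOnNhd_complexMGF.mono fun w hw => mem_interior_integrableExpSet hα hw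
  have h2 : AnalyticOnNhd ℂ (fun w : ℂ => w ^ (-((α : ℂ) + 1))) {z | 0 < z.re} :=
    fun w hw => analyticAt_id.cpow analyticAt_const (Or.inl hw)
  refine h1.eqOn_of_preconnected_of_frequently_eq h2
    (convex_halfSpace_re_gt 0).isPreconnected (z₀ := 1) (by simp) ?_ hz
  have ht : Tendsto (fun n : ℕ => ((1 + 1 / ((n : ℝ) + 1) : ℝ) : ℂ)) atTop (𝓝[≠] 1) := by
    refine tendsto_nhdsWithin_iff.2 ⟨?_, Eventually.of_forall fun n => ?_⟩
    · have := (tendsto_one_div_add_atTop_nhds_zero_nat (𝕜 := ℝ)).const_add 1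
      rw [add_zero] at this
      exact_mod_cast (Complex.continuous_ofReal.tendsto _).comp this
    · have : (0 : ℝ) < 1 / ((n : ℝ) + 1) := by positivity
      rw [mem_compl_iff, mem_singleton_iff, ← Complex.ofReal_one, Complex.ofReal_inj]
      linarith
  refine ht.frequently (Frequently.of_forall fun n => ?_)
  have : (0 : ℝ) < 1 + 1 / ((n : ℝ) + 1) := by positivity
  rw [complexMGF_ofReal, mgf, integral_exp_radialMeasure hα this, Complex.ofReal_cpow this.le]
  push_cast
  rfl

lemma integral_pow_mul_cexp_radialMeasure {α : ℝ} (hα : -1 < α) {z : ℂ} (hz : 0 < z.re) (k : ℕ) :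
    ∫ x : ℝ, (x : ℂ) ^ (2 * k) * Complex.exp (z * ((-x ^ 2 / 2 : ℝ) : ℂ)) ∂radialMeasure α =
      2 ^ k * Real.Gamma (α + k + 1) / Real.Gamma (α + 1) * z ^ (-((α : ℂ) + k + 1)) := by
  have hk : (0 : ℝ) ≤ k := Nat.cast_nonneg k
  have hG := Real.Gamma_pos_of_pos (show 0 < α + 1 by linarith)
  have hGk := Real.Gamma_pos_of_pos (show 0 < α + k + 1 by linarith)
  have h := integral_cexp_radialMeasure (show -1 < α + k by linarith) hz
  push_cast at h
  rw [← h, integral_radialMeasure hα, integral_radialMeasure (by linarith), ← integral_const_mul]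
  refine setIntegral_congr_fun measurableSet_Ioi fun x hx => ?_
  have hx : (0 : ℝ) < x := hx
  simp only [Complex.real_smul]
  rw [show 2 * (α + k) + 1 = (2 * α + 1) + (2 * k : ℕ) by push_cast; ring, Real.rpow_add hx _ (2 * k : ℕ),
    Real.rpow_natCast, Real.rpow_add two_pos, Real.rpow_natCast]
  have h2 : ((2 : ℝ) ^ α : ℝ) ≠ 0 := by positivity
  have h2' := Complex.ofReal_ne_zero.2 h2
  have h3 := Complex.ofReal_ne_zero.2 hG.ne'
  have h4 := Complex.ofReal_ne_zero.2 hGk.ne'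
  push_cast
  field_simp

/-- Scaling of the Weinstein measure. -/
lemma lintegral_comp_smul_measure {d : ℕ} {α : ℝ} {σ : ℝ} (hσ : 0 < σ) {f : Space d → ℝ≥0∞}
    (hf : Measurable f) :
    ∫⁻ x, f (σ • x) ∂measure d α =
      ENNReal.ofReal (σ ^ (-(2 * α + d + 2))) * ∫⁻ x, f x ∂measure d α := by
  set C := (2 * Real.pi) ^ ((d : ℝ) / 2) * 2 ^ α * Real.Gamma (α + 1)
  have hw : ∀ g : Space d → ℝ≥0∞, Measurable g → ∫⁻ x, g x ∂measure d α =
      ∫⁻ x, (halfSpace d).indicator (fun x => ENNReal.ofReal (x.2 ^ (2 * α + 1) / C) * g x) x := by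
    intro g hg
    rw [measure, lintegral_withDensity_eq_lintegral_mul _ (by fun_prop) hg,
      lintegral_indicator (measurableSet_halfSpace d)]
    rfl
  have hg := (show Measurable fun x : Space d => ENNReal.ofReal (x.2 ^ (2 * α + 1) / C) * f x by
    fun_prop).indicator (measurableSet_halfSpace d)
  rw [hw _ (by fun_prop), hw _ hf]
  have : (volume : Measure (Space d)).IsAddHaarMeasure :=
    inferInstanceAs ((volume.prod volume).IsAddHaarMeasure)
  have hmap := Measure.map_addHaar_smul (volume : Measure (Space d)) hσ.ne'
  have key := lintegral_map (μ := (volume : Measure (Space d))) hg (measurable_const_smul σ)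
  rw [hmap, lintegral_smul_measure] at key
  have hpt : ∀ x : Space d, (halfSpace d).indicator
      (fun x => ENNReal.ofReal (x.2 ^ (2 * α + 1) / C) * f (σ • x)) x =
      ENNReal.ofReal (σ ^ (-(2 * α + 1))) * (halfSpace d).indicator
      (fun x => ENNReal.ofReal (x.2 ^ (2 * α + 1) / C) * f x) (σ • x) := by
    intro x
    by_cases hx : x ∈ halfSpace d
    · have hx' : σ • x ∈ halfSpace d := mul_pos hσ hx
      have hx0 : 0 < x.2 := hx
      rw [indicator_of_mem hx, indicator_of_mem hx', ← mul_assoc,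
        ← ENNReal.ofReal_mul (by positivity), Prod.smul_snd, smul_eq_mul,
        Real.mul_rpow hσ.le hx0.le, Real.rpow_neg hσ.le]
      congr 2
      field_simp
    · have hx' : σ • x ∉ halfSpace d := fun h => hx (pos_of_mul_pos_right (a := σ) h hσ.le)
      rw [indicator_of_notMem hx, indicator_of_notMem hx', mul_zero]
  simp_rw [hpt]
  have hgσ : Measurable fun x : Space d => (halfSpace d).indicator
      (fun x => ENNReal.ofReal (x.2 ^ (2 * α + 1) / C) * f x) (σ • x) :=
    hg.comp (measurable_const_smul σ)
  rw [lintegral_const_mul _ hgσ, ← key, smul_eq_mul, ← mul_assoc,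
    ← ENNReal.ofReal_mul (by positivity)]
  congr 2
  have hfr : Module.finrank ℝ (Space d) = d + 1 := by simp
  rw [hfr, abs_of_pos (by positivity), ← Real.rpow_natCast, ← Real.rpow_neg hσ.le,
    ← Real.rpow_add hσ]
  congr 1
  push_cast
  ring

lemma quasiMeasurePreserving_smul {d : ℕ} {α : ℝ} {σ : ℝ} (hσ : 0 < σ) :
    Measure.QuasiMeasurePreserving (fun x : Space d => σ • x) (measure d α) (measure d α) := by
  refine ⟨measurable_const_smul σ, Measure.AbsolutelyContinuous.mk fun s hs h0 => ?_⟩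
  rw [Measure.map_apply (measurable_const_smul σ) hs,
    ← lintegral_indicator_one (measurable_const_smul σ hs)]
  have := lintegral_comp_smul_measure (α := α) hσ (f := s.indicator 1)
    (measurable_one.indicator hs)
  rw [lintegral_indicator_one hs, h0, mul_zero] at this
  exact this

lemma kernel_comm {d : ℕ} (α : ℝ) (x y : Space d) : kernel α x y = kernel α y x := by
  simp only [kernel, real_inner_comm, mul_comm]

@[simp] lemma reflect_reflect {d : ℕ} (x : Space d) : reflect (reflect x) = x := by
  simp [reflect]

lemma continuous_reflect {d : ℕ} : Continuous (reflect : Space d → Space d) := by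
  unfold reflect; fun_prop

lemma conj_kernel {d : ℕ} (α : ℝ) (x y : Space d) :
    (starRingEnd ℂ) (kernel α y x) = kernel α (reflect y) x := by
  simp [kernel, reflect, ← Complex.exp_conj]

lemma norm_kernel_le_one {d : ℕ} {α : ℝ} (hα : -(1 / 2) < α) (x y : Space d) :
    ‖kernel α y x‖ ≤ 1 := by
  rw [kernel, norm_mul, Complex.norm_exp, Complex.norm_real]
  simpa using abs_besselJ_le_one hα (x.2 * y.2)

lemma continuous_kernel {d : ℕ} {α : ℝ} (hα : -(1 / 2) < α) :
    Continuous (Function.uncurry fun y x : Space d => kernel α y x) := by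
  have := continuous_besselJ hα
  unfold kernel Function.uncurry
  fun_prop

lemma continuous_kernel_right {d : ℕ} {α : ℝ} (hα : -(1 / 2) < α) (y : Space d) :
    Continuous fun x : Space d => kernel α y x :=
  (continuous_kernel hα).uncurry_left y

lemma continuous_kernel_left {d : ℕ} {α : ℝ} (hα : -(1 / 2) < α) (x : Space d) :
    Continuous fun y : Space d => kernel α y x :=
  (continuous_kernel hα).uncurry_right x

section transform

variable {d : ℕ} {α : ℝ} {f g : Space d → ℂ}

lemma integrable_mul_kernel (hα : -(1 / 2) < α) (hf : Integrable f (measure d α)) (y : Space d) :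
    Integrable (fun x => f x * kernel α y x) (measure d α) :=
  hf.mul_bdd (c := 1) (continuous_kernel_right hα y).aestronglyMeasurable
    (ae_of_all _ fun x => norm_kernel_le_one hα x y)

lemma continuous_transform (hα : -(1 / 2) < α) (hf : Integrable f (measure d α)) :
    Continuous (transform α f) := by
  unfold transform
  refine continuous_of_dominated (bound := fun x => ‖f x‖)
    (fun y => (integrable_mul_kernel hα hf y).aestronglyMeasurable)
    (fun y => ae_of_all _ fun x => ?_) hf.norm
    (ae_of_all _ fun x => continuous_const.mul (continuous_kernel_left hα x))
  rw [norm_mul]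
  exact mul_le_of_le_one_right (norm_nonneg _) (norm_kernel_le_one hα x y)

lemma enorm_transform_le (hα : -(1 / 2) < α) (y : Space d) :
    ‖transform α f y‖ₑ ≤ ∫⁻ x, ‖f x‖ₑ ∂measure d α := by
  refine (enorm_integral_le_lintegral_enorm _).trans (lintegral_mono fun x => ?_)
  rw [enorm_mul]
  refine mul_le_of_le_one_right' ?_
  have := norm_kernel_le_one hα x y
  rw [← enorm_norm, Real.enorm_of_nonneg (norm_nonneg _)]
  exact ENNReal.ofReal_le_one.2 this

lemma transform_add (hα : -(1 / 2) < α) (hf : Integrable f (measure d α))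
    (hg : Integrable g (measure d α)) : transform α (f + g) = transform α f + transform α g := by
  ext y
  simp only [transform, Pi.add_apply, add_mul]
  exact integral_add (integrable_mul_kernel hα hf y) (integrable_mul_kernel hα hg y)

lemma transform_sub (hα : -(1 / 2) < α) (hf : Integrable f (measure d α))
    (hg : Integrable g (measure d α)) : transform α (f - g) = transform α f - transform α g := by
  ext y
  simp only [transform, Pi.sub_apply, sub_mul]
  exact integral_sub (integrable_mul_kernel hα hf y) (integrable_mul_kernel hα hg y)

lemma transform_smul (c : ℂ) : transform α (c • f) = c • transform α f := by
  ext y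
  simp only [transform, Pi.smul_apply, smul_eq_mul, mul_assoc]
  exact integral_const_mul _ _

lemma transform_congr_ae (h : f =ᵐ[measure d α] g) : transform α f = transform α g := by
  ext y
  exact integral_congr_ae (h.mono fun x hx => by simp only [hx])

lemma conj_transform (y : Space d) : (starRingEnd ℂ) (transform α f y) =
    transform α (fun x => (starRingEnd ℂ) (f x)) (reflect y) := by
  simp only [transform, ← integral_conj, map_mul, conj_kernel]

/-- The multiplication formula. -/
lemma integral_transform_mul (hα : -(1 / 2) < α) (hf : Integrable f (measure d α))
    (hg : Integrable g (measure d α)) :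
    ∫ y, transform α f y * g y ∂measure d α = ∫ x, f x * transform α g x ∂measure d α := by
  simp only [transform, ← integral_mul_const, ← integral_const_mul]
  rw [integral_integral_swap]
  · refine integral_congr_ae (ae_of_all _ fun x => integral_congr_ae (ae_of_all _ fun y => ?_))
    simp only [kernel_comm α x y]
    ring
  · refine ((hg.mul_prod hf).mul_bdd (c := 1)
      (g := Function.uncurry fun y x : Space d => kernel α y x)
      (continuous_kernel hα).aestronglyMeasurable
      (ae_of_all _ fun p => norm_kernel_le_one hα p.2 p.1)).congr (ae_of_all _ fun p => ?_)
    simp only [Function.uncurry]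
    ring

end transform

lemma integral_pow_mul_exp_radialMeasure {α : ℝ} (hα : -1 < α) {s : ℝ} (hs : 0 < s) (k : ℕ) :
    ∫ x : ℝ, x ^ (2 * k) * Real.exp (s * (-x ^ 2 / 2)) ∂radialMeasure α =
      2 ^ k * Real.Gamma (α + k + 1) / Real.Gamma (α + 1) * s ^ (-(α + k + 1)) := by
  have h := integral_pow_mul_cexp_radialMeasure hα (z := s) (by simpa) k
  apply Complex.ofReal_injective
  rw [← integral_complex_ofReal]
  push_cast [Complex.ofReal_cpow hs.le] at h ⊢
  exact h

lemma integrable_pow_mul_exp_radialMeasure {α : ℝ} (hα : -1 < α) {s : ℝ} (hs : 0 < s) (k : ℕ) :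
    Integrable (fun x : ℝ => x ^ (2 * k) * Real.exp (s * (-x ^ 2 / 2))) (radialMeasure α) := by
  have hG := Real.Gamma_pos_of_pos (show 0 < α + 1 by linarith)
  have hGk := Real.Gamma_pos_of_pos (show 0 < α + k + 1 by
    linarith [(Nat.cast_nonneg k : (0 : ℝ) ≤ k)])
  refine .of_integral_ne_zero ?_
  rw [integral_pow_mul_exp_radialMeasure hα hs]
  positivity

/-- The Hankel transform of a Gaussian is a Gaussian. -/
lemma integral_cexp_mul_besselJ {α : ℝ} (hα : -1 < α) {z : ℂ} (hz : 0 < z.re) (y : ℝ) :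
    ∫ x : ℝ, Complex.exp (z * ((-x ^ 2 / 2 : ℝ) : ℂ)) * (besselJ α (x * y) : ℂ) ∂radialMeasure α =
      z ^ (-((α : ℂ) + 1)) * Complex.exp (z⁻¹ * ((-y ^ 2 / 2 : ℝ) : ℂ)) := by
  have hz0 : z ≠ 0 := fun h => by simp [h] at hz
  have hG := Real.Gamma_pos_of_pos (show 0 < α + 1 by linarith)
  have hGk : ∀ k : ℕ, 0 < Real.Gamma (α + k + 1) := fun k => Real.Gamma_pos_of_pos (by
    linarith [(Nat.cast_nonneg k : (0 : ℝ) ≤ k)])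
  set a : ℕ → ℝ := fun k => Real.Gamma (α + 1) * ((-1) ^ k * y ^ (2 * k) /
    (2 ^ (2 * k) * k.factorial * Real.Gamma (α + k + 1))) with ha
  set F : ℕ → ℝ → ℂ := fun k x =>
    (a k : ℂ) * ((x : ℂ) ^ (2 * k) * Complex.exp (z * ((-x ^ 2 / 2 : ℝ) : ℂ))) with hF
  have hnorm : ∀ k x, ‖F k x‖ = |a k| * (x ^ (2 * k) * Real.exp (z.re * (-x ^ 2 / 2))) := by
    intro k x
    rw [hF, norm_mul, norm_mul, norm_pow, Complex.norm_exp, Complex.re_mul_ofReal,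
      Complex.norm_real, Complex.norm_real, Real.norm_eq_abs, Real.norm_eq_abs, pow_mul |x|,
      sq_abs, ← pow_mul]
  have hint : ∀ k, Integrable (F k) (radialMeasure α) := by
    intro k
    rw [← integrable_norm_iff (by fun_prop)]
    simp_rw [hnorm]
    exact (integrable_pow_mul_exp_radialMeasure hα hz k).const_mul _
  have hsum : Summable fun k => ∫ x, ‖F k x‖ ∂radialMeasure α := by
    have := (Real.summable_pow_div_factorial (y ^ 2 / (2 * z.re))).mul_left (z.re ^ (-(α + 1)))
    refine this.congr fun k => ?_
    simp_rw [hnorm]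
    rw [integral_const_mul, integral_pow_mul_exp_radialMeasure hα hz, ha,
      show -(α + k + 1) = -(α + 1) - k by ring, Real.rpow_sub hz, Real.rpow_natCast]
    have hy : |y| ^ (2 * k) = y ^ (2 * k) := by rw [pow_mul, sq_abs, ← pow_mul]
    simp only [abs_mul, abs_div, abs_pow, abs_neg, abs_one, one_pow, one_mul, Nat.abs_cast, hy,
      abs_of_pos hG, abs_of_pos (hGk k), abs_two]
    have := hGk k
    rw [pow_mul (2 : ℝ), pow_mul y, div_pow, mul_pow]
    field_simp
    rw [show (2 : ℝ) ^ 2 = 2 * 2 by norm_num, mul_pow]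
    ring
  have key := hasSum_integral_of_summable_integral_norm hint hsum
  have hj : ∀ x : ℝ, Complex.exp (z * ((-x ^ 2 / 2 : ℝ) : ℂ)) * (besselJ α (x * y) : ℂ) =
      ∑' k, F k x := by
    intro x
    rw [besselJ, ← tsum_mul_left, Complex.ofReal_tsum, ← tsum_mul_left]
    refine tsum_congr fun k => ?_
    rw [hF, ha]
    push_cast
    ring
  simp_rw [hj]
  rw [← key.tsum_eq]
  have hexp := (NormedSpace.expSeries_div_hasSum_exp (z⁻¹ * ((-y ^ 2 / 2 : ℝ) : ℂ))).mul_left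
    (z ^ (-((α : ℂ) + 1)))
  rw [← Complex.exp_eq_exp_ℂ] at hexp
  rw [← hexp.tsum_eq]
  refine tsum_congr fun k => ?_
  rw [hF, integral_const_mul, integral_pow_mul_cexp_radialMeasure hα hz,
    show -((α : ℂ) + k + 1) = -((α : ℂ) + 1) - k by ring, Complex.cpow_sub _ _ hz0,
    Complex.cpow_natCast, ha]
  have h1 := Complex.ofReal_ne_zero.2 hG.ne'
  have h2 := Complex.ofReal_ne_zero.2 (hGk k).ne'
  push_cast
  rw [show (-(y : ℂ) ^ 2 / 2) = (-1) * (y ^ 2 / 2) by ring, mul_pow, mul_pow, inv_pow, div_pow,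
    pow_mul (2 : ℂ), pow_mul (y : ℂ), show (2 : ℂ) ^ 2 = 2 * 2 by norm_num, mul_pow]
  field_simp

/-- The Gaussian with complex linear parameter `w` and complex radial parameter `z`. -/
def gaussian {d : ℕ} (w : Fin d → ℂ) (z : ℂ) (x : Space d) : ℂ :=
  Complex.exp (-(1 / 2) * (‖x.1‖ : ℂ) ^ 2 + ∑ i, w i * (x.1 i : ℂ)) *
    Complex.exp (z * ((-x.2 ^ 2 / 2 : ℝ) : ℂ))

lemma integrable_cexp_euclideanSpace {d : ℕ} {b : ℂ} (hb : 0 < b.re) (w : Fin d → ℂ) :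
    Integrable fun v : EuclideanSpace ℝ (Fin d) =>
      Complex.exp (-b * (‖v‖ : ℂ) ^ 2 + ∑ i, w i * (v i : ℂ)) := by
  rw [← (PiLp.volume_preserving_toLp (Fin d)).integrable_comp_emb
    (MeasurableEquiv.toLp 2 _).measurableEmbedding]
  convert! GaussianFourier.integrable_cexp_neg_mul_sum_add hb w using 3 with v
  simp only [Function.comp_apply, EuclideanSpace.norm_eq,
    Real.norm_eq_abs, sq_abs]
  norm_cast
  rw [Real.sq_sqrt (by positivity)]

lemma integral_cexp_euclideanSpace {d : ℕ} (w : Fin d → ℂ) :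
    ∫ v : EuclideanSpace ℝ (Fin d),
      Complex.exp (-(1 / 2) * (‖v‖ : ℂ) ^ 2 + ∑ i, w i * (v i : ℂ)) =
      ((2 * Real.pi) ^ ((d : ℝ) / 2) : ℝ) * Complex.exp ((∑ i, w i ^ 2) / 2) := by
  rw [← (PiLp.volume_preserving_toLp (Fin d)).integral_comp
    (MeasurableEquiv.toLp 2 _).measurableEmbedding]
  have := GaussianFourier.integral_cexp_neg_mul_sum_add (b := 1 / 2) (by norm_num) w
  rw [Complex.ofReal_cpow (by positivity)]
  convert! this using 3
  · simp only [EuclideanSpace.norm_eq, Real.norm_eq_abs, sq_abs]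
    norm_cast
    rw [Real.sq_sqrt (by positivity)]
  · push_cast
    ring
  · simp
  · norm_num

section gaussian

variable {d : ℕ} {α : ℝ}

lemma integrable_gaussian (hα : -1 < α) (w : Fin d → ℂ) {z : ℂ} (hz : 0 < z.re) :
    Integrable (gaussian w z) (measure d α) := by
  rw [measure_eq_prod]
  exact ((integrable_cexp_euclideanSpace (by norm_num) w).smul_measure
    ENNReal.ofReal_ne_top).mul_prod (integrable_cexp_radialMeasure hα hz)

lemma continuous_gaussian (w : Fin d → ℂ) (z : ℂ) : Continuous (gaussian w z) := by
  unfold gaussian; fun_prop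

lemma memLp_two_gaussian (hα : -1 < α) (w : Fin d → ℂ) {z : ℂ} (hz : 0 < z.re) :
    MemLp (gaussian w z) 2 (measure d α) := by
  rw [memLp_two_iff_integrable_sq_norm (continuous_gaussian w z).aestronglyMeasurable]
  have : Integrable (fun x : Space d => Complex.exp (-1 * (‖x.1‖ : ℂ) ^ 2 +
      ∑ i, (2 * w i) * (x.1 i : ℂ)) * Complex.exp ((2 * z) * ((-x.2 ^ 2 / 2 : ℝ) : ℂ)))
      (measure d α) := by
    rw [measure_eq_prod]
    exact ((integrable_cexp_euclideanSpace (by norm_num) (fun i => 2 * w i)).smul_measure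
      ENNReal.ofReal_ne_top).mul_prod (integrable_cexp_radialMeasure hα (z := 2 * z) (by simpa))
  refine this.norm.congr (ae_of_all _ fun x => ?_)
  simp only [gaussian]
  rw [← norm_pow, mul_pow, ← Complex.exp_nat_mul, ← Complex.exp_nat_mul]
  simp only [mul_assoc, ← Finset.mul_sum]
  congr 3
  push_cast
  ring

lemma conj_gaussian (w : Fin d → ℂ) (z : ℂ) (x : Space d) : (starRingEnd ℂ) (gaussian w z x) =
    gaussian (fun i => (starRingEnd ℂ) (w i)) ((starRingEnd ℂ) z) x := by
  have h2 : (starRingEnd ℂ) 2 = 2 := Complex.conj_ofNat 2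
  simp [gaussian, ← Complex.exp_conj, h2]

lemma transform_gaussian (hα : -1 < α) (w : Fin d → ℂ) {z : ℂ} (hz : 0 < z.re) :
    transform α (gaussian w z) =
      (Complex.exp ((∑ i, w i ^ 2) / 2) * z ^ (-((α : ℂ) + 1))) •
        gaussian (fun i => -Complex.I * w i) z⁻¹ := by
  ext y
  have h : ∀ x : Space d, gaussian w z x * kernel α y x =
      Complex.exp (-(1 / 2) * (‖x.1‖ : ℂ) ^ 2 + ∑ i, (w i - Complex.I * y.1 i) * (x.1 i : ℂ)) *
      (Complex.exp (z * ((-x.2 ^ 2 / 2 : ℝ) : ℂ)) * (besselJ α (x.2 * y.2) : ℂ)) := by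
    intro x
    have : Complex.exp (-(1 / 2) * (‖x.1‖ : ℂ) ^ 2 + ∑ i, (w i - Complex.I * y.1 i) * (x.1 i : ℂ)) =
        Complex.exp (-(1 / 2) * (‖x.1‖ : ℂ) ^ 2 + ∑ i, w i * (x.1 i : ℂ)) *
        Complex.exp (-Complex.I * ((inner ℝ x.1 y.1 : ℝ) : ℂ)) := by
      rw [← Complex.exp_add]
      congr 1
      simp only [sub_mul, Finset.sum_sub_distrib, PiLp.inner_apply, RCLike.inner_apply,
        conj_trivial, Complex.ofReal_sum, Complex.ofReal_mul, Finset.mul_sum, mul_assoc, neg_mul,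
        Finset.sum_neg_distrib]
      ring
    rw [this, gaussian, kernel]
    ring
  simp only [transform]
  simp_rw [h]
  rw [measure_eq_prod, integral_prod_mul
    (fun v : EuclideanSpace ℝ (Fin d) => Complex.exp (-(1 / 2) * (‖v‖ : ℂ) ^ 2 +
      ∑ i, (w i - Complex.I * y.1 i) * (v i : ℂ)))
    (fun x : ℝ => Complex.exp (z * ((-x ^ 2 / 2 : ℝ) : ℂ)) * (besselJ α (x * y.2) : ℂ)),
    integral_smul_measure, integral_cexp_euclideanSpace, integral_cexp_mul_besselJ hα hz,
    ENNReal.toReal_ofReal (by positivity), Complex.real_smul, ← mul_assoc (Complex.ofReal _),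
    ← Complex.ofReal_mul, inv_mul_cancel₀ (by positivity), Complex.ofReal_one, one_mul,
    Pi.smul_apply, smul_eq_mul, gaussian]
  have : Complex.exp ((∑ i, (w i - Complex.I * y.1 i) ^ 2) / 2) =
      Complex.exp ((∑ i, w i ^ 2) / 2) *
        Complex.exp (-(1 / 2) * (‖y.1‖ : ℂ) ^ 2 + ∑ i, (-Complex.I * w i) * (y.1 i : ℂ)) := by
    rw [← Complex.exp_add]
    congr 1
    have hn : ((‖y.1‖ : ℂ)) ^ 2 = ∑ i, (y.1 i : ℂ) ^ 2 := by
      rw [← Complex.ofReal_pow, EuclideanSpace.real_norm_sq_eq]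
      push_cast
      rfl
    rw [hn, Finset.sum_div, Finset.sum_div, Finset.mul_sum, ← Finset.sum_add_distrib,
      ← Finset.sum_add_distrib]
    refine Finset.sum_congr rfl fun i _ => ?_
    linear_combination (1 / 2) * (y.1 i : ℂ) ^ 2 * Complex.I_sq
  rw [this]
  ring

lemma inv_re_pos {z : ℂ} (hz : 0 < z.re) : 0 < (z⁻¹).re := by
  rw [Complex.inv_re]
  exact div_pos hz (Complex.normSq_pos.2 fun h => by simp [h] at hz)

lemma inverseTransform_transform_gaussian (hα : -1 < α) (w : Fin d → ℂ) {z : ℂ}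
    (hz : 0 < z.re) : inverseTransform α (transform α (gaussian w z)) = gaussian w z := by
  ext y
  have hz0 : z ≠ 0 := fun h => by simp [h] at hz
  have harg : z.arg ≠ Real.pi := by
    intro h
    rw [Complex.arg_eq_pi_iff] at h
    linarith [h.1]
  rw [inverseTransform, transform_gaussian hα w hz, transform_smul,
    transform_gaussian hα _ (inv_re_pos hz)]
  have h1 : gaussian (fun i => -Complex.I * (-Complex.I * w i)) z⁻¹⁻¹ (reflect y) =
      gaussian w z y := by
    rw [inv_inv]
    simp [gaussian, reflect, ← mul_assoc]
  have h2 : Complex.exp ((∑ i, (-Complex.I * w i) ^ 2) / 2) =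
      (Complex.exp ((∑ i, w i ^ 2) / 2))⁻¹ := by
    rw [← Complex.exp_neg]
    simp [mul_pow, neg_div]
  simp only [Pi.smul_apply, smul_eq_mul]
  rw [h1, h2, Complex.inv_cpow _ _ harg]
  have := Complex.exp_ne_zero ((∑ i, w i ^ 2) / 2)
  have h3 : z ^ (-((α : ℂ) + 1)) ≠ 0 := by simp [Complex.cpow_eq_zero_iff, hz0]
  field_simp

end gaussian

lemma ae_eq_zero_of_integral_mul_cexp_dual_comp {X E : Type*} [MeasurableSpace X]
    [NormedAddCommGroup E] [NormedSpace ℝ E] [CompleteSpace E] [MeasurableSpace E] [BorelSpace E]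
    [SecondCountableTopology E] {μ : Measure X} {f : X → ℝ} (hf : Integrable f μ) {Q : X → E}
    (hQ : Measurable Q) {T : E → X} (hT : Measurable T) (hTQ : ∀ᵐ x ∂μ, T (Q x) = x)
    (h : ∀ L : StrongDual ℝ E, ∫ x, (f x : ℂ) * Complex.exp (L (Q x) * Complex.I) ∂μ = 0) :
    f =ᵐ[μ] 0 := by
  have hm₁ : AEMeasurable (fun x => ENNReal.ofReal (f x)) μ := hf.aemeasurable.ennreal_ofReal
  have hm₂ : AEMeasurable (fun x => ENNReal.ofReal (-f x)) μ := hf.aemeasurable.neg.ennreal_ofReal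
  set μ₁ := μ.withDensity fun x => ENNReal.ofReal (f x) with hμ₁
  set μ₂ := μ.withDensity fun x => ENNReal.ofReal (-f x) with hμ₂
  have : IsFiniteMeasure μ₁ := isFiniteMeasure_withDensity_ofReal hf.2
  have : IsFiniteMeasure μ₂ := isFiniteMeasure_withDensity_ofReal hf.neg.2
  have hback : ∀ ν : Measure X, ν ≪ μ → (ν.map Q).map T = ν := by
    intro ν hν
    rw [Measure.map_map hT hQ]
    conv_rhs => rw [← Measure.map_id (μ := ν)]
    exact Measure.map_congr (hν hTQ)
  have hmap : μ₁.map Q = μ₂.map Q := by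
    refine Measure.ext_of_charFunDual (funext fun L => ?_)
    rw [charFunDual_apply, charFunDual_apply, integral_map hQ.aemeasurable (by fun_prop),
      integral_map hQ.aemeasurable (by fun_prop), hμ₁, hμ₂,
      integral_withDensity_eq_integral_toReal_smul₀ hm₁ (ae_of_all _ fun _ => ENNReal.ofReal_lt_top),
      integral_withDensity_eq_integral_toReal_smul₀ hm₂ (ae_of_all _ fun _ => ENNReal.ofReal_lt_top),
      ← sub_eq_zero]
    have hb : ∀ x, ‖Complex.exp (L (Q x) * Complex.I)‖ ≤ 1 := fun x =>
      (Complex.norm_exp_ofReal_mul_I _).le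
    have hmeas : AEStronglyMeasurable (fun x => Complex.exp (L (Q x) * Complex.I)) μ := by
      have : Measurable fun x => L (Q x) := L.continuous.measurable.comp hQ
      exact Measurable.aestronglyMeasurable (by fun_prop)
    have hi : ∀ g : X → ℝ, Integrable g μ → Integrable
        (fun x => (ENNReal.ofReal (g x)).toReal • Complex.exp (L (Q x) * Complex.I)) μ := by
      intro g hg
      refine hg.mono (AEStronglyMeasurable.smul
        hg.aemeasurable.ennreal_ofReal.ennreal_toReal.aestronglyMeasurable hmeas)
        (ae_of_all _ fun x => ?_)
      rw [norm_smul, Real.norm_of_nonneg ENNReal.toReal_nonneg, ENNReal.toReal_ofReal']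
      refine (mul_le_of_le_one_right (le_max_right _ _) (hb x)).trans ?_
      exact max_le (le_abs_self _) (abs_nonneg _)
    rw [← integral_sub (hi f hf) (hi (fun x => -f x) hf.neg), ← h L]
    refine integral_congr_ae (ae_of_all _ fun x => ?_)
    beta_reduce
    rw [← sub_smul, ENNReal.toReal_ofReal', ENNReal.toReal_ofReal', Complex.real_smul]
    congr 2
    rcases le_total 0 (f x) with h0 | h0
    · rw [max_eq_left h0, max_eq_right (by linarith), sub_zero]
    · rw [max_eq_right h0, max_eq_left (by linarith), zero_sub, neg_neg]
  have heq : μ₁ = μ₂ := by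
    rw [← hback μ₁ (withDensity_absolutelyContinuous _ _),
      ← hback μ₂ (withDensity_absolutelyContinuous _ _), hmap]
  have hfin : ∫⁻ x, ENNReal.ofReal (f x) ∂μ ≠ ∞ := by
    have := measure_ne_top μ₁ univ
    rwa [hμ₁, withDensity_apply _ MeasurableSet.univ, Measure.restrict_univ] at this
  filter_upwards [(withDensity_eq_iff hm₁ hm₂ hfin).1 heq] with x hx
  rcases le_total 0 (f x) with h0 | h0
  · rw [ENNReal.ofReal_of_nonpos (by linarith : -f x ≤ 0), ENNReal.ofReal_eq_zero] at hx
    exact le_antisymm hx h0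
  · rw [ENNReal.ofReal_of_nonpos h0, eq_comm, ENNReal.ofReal_eq_zero] at hx
    exact le_antisymm h0 (neg_nonpos.1 hx)

section totality

variable {d : ℕ} {α : ℝ}

lemma gaussian_ne_zero (w : Fin d → ℂ) (z : ℂ) (x : Space d) : gaussian w z x ≠ 0 :=
  mul_ne_zero (Complex.exp_ne_zero _) (Complex.exp_ne_zero _)

/-- The Gaussians form a total family. -/
lemma ae_eq_zero_of_integral_mul_gaussian {k : Space d → ℂ}
    (hk : Integrable (fun x => k x * gaussian 0 1 x) (measure d α))
    (h : ∀ (w : Fin d → ℂ) (z : ℂ), 0 < z.re → ∫ x, k x * gaussian w z x ∂measure d α = 0) :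
    k =ᵐ[measure d α] 0 := by
  set Q : Space d → Space d := fun x => (x.1, -x.2 ^ 2 / 2) with hQ
  set T : Space d → Space d := fun x => (x.1, √(-2 * x.2)) with hT
  set g : Space d → ℂ := fun x => k x * gaussian 0 1 x with hg
  have hTQ : ∀ᵐ x ∂measure d α, T (Q x) = x := by
    filter_upwards [ae_measure_mem_halfSpace d α] with x hx
    have hx : 0 < x.2 := hx
    ext1
    · rfl
    · simp only [hT, hQ]
      rw [show -2 * (-x.2 ^ 2 / 2) = x.2 ^ 2 by ring, Real.sqrt_sq hx.le]
  have hL : ∀ L : StrongDual ℝ (Space d),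
      ∫ x, g x * Complex.exp (L (Q x) * Complex.I) ∂measure d α = 0 := by
    intro L
    rw [← h (fun i => L (EuclideanSpace.single i 1, 0) * Complex.I)
      (1 + L (0, 1) * Complex.I) (by simp)]
    refine integral_congr_ae (ae_of_all _ fun x => ?_)
    have hLx : L (Q x) = ∑ i, L (EuclideanSpace.single i 1, 0) * x.1 i +
        L (0, 1) * (-x.2 ^ 2 / 2) := by
      have hdec : Q x = ∑ i, x.1 i • ((EuclideanSpace.single i 1, 0) : Space d) +
          (-x.2 ^ 2 / 2) • ((0, 1) : Space d) := by
        ext1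
        · rw [Prod.fst_add, Prod.fst_sum]
          ext j
          simp [hQ, Finset.sum_apply, Pi.single_apply]
        · rw [Prod.snd_add, Prod.snd_sum]
          simp [hQ]
      rw [hdec, map_add, map_sum, map_smul, smul_eq_mul, mul_comm (L (0, 1))]
      congr 1
      refine Finset.sum_congr rfl fun i _ => ?_
      rw [map_smul, smul_eq_mul, mul_comm]
    simp only [hg, gaussian]
    rw [mul_assoc, mul_assoc, ← Complex.exp_add, ← Complex.exp_add, ← Complex.exp_add, hLx]
    congr 2
    push_cast
    simp only [Pi.zero_apply, zero_mul, Finset.sum_const_zero, Finset.sum_mul, add_mul]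
    simp only [mul_right_comm _ _ Complex.I]
    ring
  have hL' : ∀ L : StrongDual ℝ (Space d),
      ∫ x, (starRingEnd ℂ) (g x) * Complex.exp (L (Q x) * Complex.I) ∂measure d α = 0 := by
    intro L
    have := congrArg (starRingEnd ℂ) (hL (-L))
    rw [← integral_conj, map_zero] at this
    rw [← this]
    refine integral_congr_ae (ae_of_all _ fun x => ?_)
    simp [← Complex.exp_conj]
  have hbdd : ∀ (f : Space d → ℂ), Integrable f (measure d α) → ∀ L : StrongDual ℝ (Space d),
      Integrable (fun x => f x * Complex.exp (L (Q x) * Complex.I)) (measure d α) := by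
    intro f hf L
    exact hf.mul_bdd (c := 1) (Continuous.aestronglyMeasurable (by fun_prop))
      (ae_of_all _ fun x => (Complex.norm_exp_ofReal_mul_I _).le)
  have hgc : Integrable (fun x => (starRingEnd ℂ) (g x)) (measure d α) :=
    (LinearIsometryEquiv.integrable_comp_iff Complex.conjLIE).2 hk
  have hre := ae_eq_zero_of_integral_mul_cexp_dual_comp (Q := Q) (T := T) hk.re
    (by fun_prop) (by fun_prop) hTQ (fun L => by
      have : ∀ x, ((RCLike.re (g x) : ℝ) : ℂ) * Complex.exp (L (Q x) * Complex.I) =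
          (1 / 2) * (g x * Complex.exp (L (Q x) * Complex.I) +
            (starRingEnd ℂ) (g x) * Complex.exp (L (Q x) * Complex.I)) := by
        intro x
        rw [← add_mul, Complex.add_conj]
        push_cast
        simp only [RCLike.re_to_complex]
        ring
      simp_rw [hg] at this ⊢
      simp_rw [this]
      rw [integral_const_mul, integral_add (hbdd _ hk L) (hbdd _ hgc L), hL, hL', add_zero,
        mul_zero])
  have him := ae_eq_zero_of_integral_mul_cexp_dual_comp (Q := Q) (T := T) hk.im
    (by fun_prop) (by fun_prop) hTQ (fun L => by
      have : ∀ x, ((RCLike.im (g x) : ℝ) : ℂ) * Complex.exp (L (Q x) * Complex.I) =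
          (1 / (2 * Complex.I)) * (g x * Complex.exp (L (Q x) * Complex.I) -
            (starRingEnd ℂ) (g x) * Complex.exp (L (Q x) * Complex.I)) := by
        intro x
        rw [← sub_mul, Complex.sub_conj]
        have := Complex.I_ne_zero
        push_cast
        simp only [RCLike.im_to_complex]
        field_simp
      simp_rw [hg] at this ⊢
      simp_rw [this]
      rw [integral_const_mul, integral_sub (hbdd _ hk L) (hbdd _ hgc L), hL, hL', sub_zero,
        mul_zero])
  filter_upwards [hre, him] with x h1 h2
  have : g x = 0 := Complex.ext h1 h2
  exact (mul_eq_zero.1 this).resolve_right (gaussian_ne_zero _ _ _)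

end totality

lemma tendsto_toLp_of_tendsto_eLpNorm_sub {X : Type*} [MeasurableSpace X] {μ : Measure X}
    {u : ℕ → X → ℂ} {f : X → ℂ} (hu : ∀ n, MemLp (u n) 2 μ) (hf : MemLp f 2 μ)
    (h : Tendsto (fun n => eLpNorm (u n - f) 2 μ) atTop (𝓝 0)) :
    Tendsto (fun n => (hu n).toLp) atTop (𝓝 hf.toLp) :=
  (Lp.tendsto_Lp_iff_tendsto_eLpNorm'' u hu f hf).2 h

lemma tendsto_eLpNorm_of_tendsto_eLpNorm_sub {X : Type*} [MeasurableSpace X] {μ : Measure X}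
    {u : ℕ → X → ℂ} {f : X → ℂ} (hu : ∀ n, MemLp (u n) 2 μ) (hf : MemLp f 2 μ)
    (h : Tendsto (fun n => eLpNorm (u n - f) 2 μ) atTop (𝓝 0)) :
    Tendsto (fun n => eLpNorm (u n) 2 μ) atTop (𝓝 (eLpNorm f 2 μ)) := by
  have := (tendsto_toLp_of_tendsto_eLpNorm_sub hu hf h).enorm
  simpa only [Lp.enorm_toLp] using this

lemma tendsto_integral_mul_of_tendsto_eLpNorm_sub {X : Type*} [MeasurableSpace X] {μ : Measure X}
    {u : ℕ → X → ℂ} {f g : X → ℂ} (hu : ∀ n, MemLp (u n) 2 μ) (hf : MemLp f 2 μ)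
    (hg : MemLp g 2 μ) (h : Tendsto (fun n => eLpNorm (u n - f) 2 μ) atTop (𝓝 0)) :
    Tendsto (fun n => ∫ x, u n x * g x ∂μ) atTop (𝓝 (∫ x, f x * g x ∂μ)) := by
  refine tendsto_integral_of_L1' _ (hf.integrable_mul hg).aestronglyMeasurable
    (Eventually.of_forall fun n => (hu n).integrable_mul hg) ?_
  have hb : ∀ n, eLpNorm ((fun x => u n x * g x) - fun x => f x * g x) 1 μ ≤
      eLpNorm (u n - f) 2 μ * eLpNorm g 2 μ := by
    intro n
    have := eLpNorm_smul_le_mul_eLpNorm (p := 2) (q := 2) (r := 1) hg.1 ((hu n).sub hf).1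
    refine le_trans (le_of_eq ?_) this
    congr 1
    ext x
    simp only [Pi.sub_apply, Pi.smul_apply', smul_eq_mul]
    ring
  refine tendsto_of_tendsto_of_tendsto_of_le_of_le tendsto_const_nhds ?_ (fun _ => zero_le) hb
  simpa using ENNReal.Tendsto.mul_const h (Or.inr hg.eLpNorm_ne_top)

/-- The linear span of the Gaussians. -/
def gaussianSpan (d : ℕ) : Submodule ℂ (Space d → ℂ) :=
  Submodule.span ℂ {g | ∃ (w : Fin d → ℂ) (z : ℂ), 0 < z.re ∧ g = gaussian w z}

section plancherel

variable {d : ℕ} {α : ℝ} {u f g : Space d → ℂ}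

lemma gaussian_mem_gaussianSpan (w : Fin d → ℂ) {z : ℂ} (hz : 0 < z.re) :
    gaussian w z ∈ gaussianSpan d :=
  Submodule.subset_span ⟨w, z, hz, rfl⟩

lemma integrable_of_mem_gaussianSpan (hα : -1 < α) (hu : u ∈ gaussianSpan d) :
    Integrable u (measure d α) := by
  induction hu using Submodule.span_induction with
  | mem u h => obtain ⟨w, z, hz, rfl⟩ := h; exact integrable_gaussian hα w hz
  | zero => exact integrable_zero _ _ _
  | add u v _ _ hu hv => exact hu.add hv
  | smul c u _ hu => exact hu.smul c

lemma memLp_two_of_mem_gaussianSpan (hα : -1 < α) (hu : u ∈ gaussianSpan d) :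
    MemLp u 2 (measure d α) := by
  induction hu using Submodule.span_induction with
  | mem u h => obtain ⟨w, z, hz, rfl⟩ := h; exact memLp_two_gaussian hα w hz
  | zero => exact MemLp.zero
  | add u v _ _ hu hv => exact hu.add hv
  | smul c u _ hu => exact hu.const_smul c

lemma transform_mem_gaussianSpan (hα : -(1 / 2) < α) (hu : u ∈ gaussianSpan d) :
    transform α u ∈ gaussianSpan d := by
  have hα' : -1 < α := by linarith
  induction hu using Submodule.span_induction with
  | mem u h =>
    obtain ⟨w, z, hz, rfl⟩ := h
    rw [transform_gaussian hα' w hz]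
    exact Submodule.smul_mem _ _ (gaussian_mem_gaussianSpan _ (inv_re_pos hz))
  | zero =>
    have : transform α (0 : Space d → ℂ) = 0 := by ext y; simp [transform]
    rw [this]
    exact Submodule.zero_mem _
  | add u v hu' hv' hu hv =>
    rw [transform_add hα (integrable_of_mem_gaussianSpan hα' hu')
      (integrable_of_mem_gaussianSpan hα' hv')]
    exact Submodule.add_mem _ hu hv
  | smul c u _ hu =>
    rw [transform_smul]
    exact Submodule.smul_mem _ _ hu

lemma inverseTransform_transform_of_mem_gaussianSpan (hα : -(1 / 2) < α)
    (hu : u ∈ gaussianSpan d) : inverseTransform α (transform α u) = u := by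
  have hα' : -1 < α := by linarith
  induction hu using Submodule.span_induction with
  | mem u h =>
    obtain ⟨w, z, hz, rfl⟩ := h
    exact inverseTransform_transform_gaussian hα' w hz
  | zero => ext y; simp [inverseTransform, transform]
  | add u v hu' hv' hu hv =>
    rw [transform_add hα (integrable_of_mem_gaussianSpan hα' hu')
      (integrable_of_mem_gaussianSpan hα' hv')]
    conv_rhs => rw [← hu, ← hv]
    ext y
    simp only [inverseTransform]
    rw [transform_add hα
      (integrable_of_mem_gaussianSpan hα' (transform_mem_gaussianSpan hα hu'))
      (integrable_of_mem_gaussianSpan hα' (transform_mem_gaussianSpan hα hv'))]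
    rfl
  | smul c u _ hu =>
    conv_rhs => rw [← hu]
    ext y
    simp only [inverseTransform, transform_smul]
    rfl

lemma eLpNorm_transform_of_mem_gaussianSpan (hα : -(1 / 2) < α) (hu : u ∈ gaussianSpan d) :
    eLpNorm (transform α u) 2 (measure d α) = eLpNorm u 2 (measure d α) := by
  have hα' : -1 < α := by linarith
  have hFu := transform_mem_gaussianSpan hα hu
  have hFi : Integrable (fun x => (starRingEnd ℂ) (transform α u x)) (measure d α) :=
    (LinearIsometryEquiv.integrable_comp_iff Complex.conjLIE).2
      (integrable_of_mem_gaussianSpan hα' hFu)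
  have key := integral_transform_mul hα (integrable_of_mem_gaussianSpan hα' hu) hFi
  have hinv : ∀ x, transform α (fun x => (starRingEnd ℂ) (transform α u x)) x =
      (starRingEnd ℂ) (u x) := by
    intro x
    have h1 := conj_transform (α := α) (f := transform α u) (reflect x)
    rw [reflect_reflect] at h1
    rw [← h1]
    exact congrArg _ (congrFun (inverseTransform_transform_of_mem_gaussianSpan hα hu) x)
  simp_rw [hinv, Complex.mul_conj', ← Complex.ofReal_pow] at key
  rw [integral_complex_ofReal, integral_complex_ofReal, Complex.ofReal_inj] at key
  rw [(memLp_two_of_mem_gaussianSpan hα' hFu).eLpNorm_eq_integral_rpow_norm two_ne_zero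
    ENNReal.ofNat_ne_top, (memLp_two_of_mem_gaussianSpan hα' hu).eLpNorm_eq_integral_rpow_norm
    two_ne_zero ENNReal.ofNat_ne_top]
  simp only [ENNReal.toReal_ofNat, Real.rpow_two, key]

/-- The functions in `L²` with a representative in the span of the Gaussians. -/
def gaussianLp (d : ℕ) (α : ℝ) : Submodule ℂ (Lp ℂ 2 (measure d α)) where
  carrier := {v | ∃ u ∈ gaussianSpan d, v =ᵐ[measure d α] u}
  zero_mem' := ⟨0, Submodule.zero_mem _, Lp.coeFn_zero _ _ _⟩
  add_mem' := by
    rintro v w ⟨u, hu, hv⟩ ⟨u', hu', hw⟩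
    exact ⟨u + u', Submodule.add_mem _ hu hu', (Lp.coeFn_add v w).trans (hv.add hw)⟩
  smul_mem' := by
    rintro c v ⟨u, hu, hv⟩
    exact ⟨c • u, Submodule.smul_mem _ c hu, (Lp.coeFn_smul c v).trans (hv.const_smul c)⟩

lemma topologicalClosure_gaussianLp (hα : -1 < α) : (gaussianLp d α).topologicalClosure = ⊤ := by
  rw [Submodule.topologicalClosure_eq_top_iff, Submodule.eq_bot_iff]
  intro v hv
  rw [Lp.eq_zero_iff_ae_eq_zero]
  refine ae_eq_zero_of_integral_mul_gaussian
    ((Lp.memLp v).integrable_mul (memLp_two_gaussian hα 0 (by simp))) fun w z hz => ?_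
  set w' : Fin d → ℂ := fun i => (starRingEnd ℂ) (w i)
  have hz' : 0 < ((starRingEnd ℂ) z).re := by simpa
  have hG := memLp_two_gaussian hα w' hz'
  have h := hv hG.toLp ⟨_, gaussian_mem_gaussianSpan w' hz', hG.coeFn_toLp⟩
  rw [L2.inner_def] at h
  rw [← h]
  refine integral_congr_ae ?_
  filter_upwards [hG.coeFn_toLp] with x hx
  rw [hx, RCLike.inner_apply, conj_gaussian]
  simp [w']

lemma exists_seq_gaussianSpan (hα : -1 < α) (hf : MemLp f 2 (measure d α)) :
    ∃ u : ℕ → Space d → ℂ, (∀ n, u n ∈ gaussianSpan d) ∧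
      Tendsto (fun n => eLpNorm (u n - f) 2 (measure d α)) atTop (𝓝 0) := by
  have hmem : hf.toLp ∈ closure (gaussianLp d α : Set (Lp ℂ 2 (measure d α))) := by
    rw [← Submodule.topologicalClosure_coe, topologicalClosure_gaussianLp hα]
    trivial
  obtain ⟨v, hv, hlim⟩ := mem_closure_iff_seq_limit.1 hmem
  choose u hu hvu using hv
  have hu2 := fun n => memLp_two_of_mem_gaussianSpan hα (hu n)
  refine ⟨u, hu, (Lp.tendsto_Lp_iff_tendsto_eLpNorm'' u hu2 f hf).1 ?_⟩
  convert! hlim using 2 with n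
  exact Lp.ext ((hu2 n).coeFn_toLp.trans (hvu n).symm)

/-- A sequence in the span of the Gaussians that converges in `L²` has convergent transforms. -/
lemma exists_tendsto_transform (hα : -(1 / 2) < α) {u : ℕ → Space d → ℂ}
    (hu : ∀ n, u n ∈ gaussianSpan d) (hf : MemLp f 2 (measure d α))
    (h : Tendsto (fun n => eLpNorm (u n - f) 2 (measure d α)) atTop (𝓝 0)) :
    ∃ g, MemLp g 2 (measure d α) ∧
      Tendsto (fun n => eLpNorm (transform α (u n) - g) 2 (measure d α)) atTop (𝓝 0) := by
  have hα' : -1 < α := by linarith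
  have hu2 := fun n => memLp_two_of_mem_gaussianSpan hα' (hu n)
  have hF2 := fun n => memLp_two_of_mem_gaussianSpan hα' (transform_mem_gaussianSpan hα (hu n))
  have hc := (tendsto_toLp_of_tendsto_eLpNorm_sub hu2 hf h).cauchySeq
  have hc' : CauchySeq fun n => (hF2 n).toLp := by
    rw [Metric.cauchySeq_iff] at hc ⊢
    intro ε hε
    obtain ⟨N, hN⟩ := hc ε hε
    refine ⟨N, fun m hm n hn => ?_⟩
    have := hN m hm n hn
    rw [dist_edist, Lp.edist_toLp_toLp] at this ⊢
    rwa [← transform_sub hα (integrable_of_mem_gaussianSpan hα' (hu m))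
      (integrable_of_mem_gaussianSpan hα' (hu n)),
      eLpNorm_transform_of_mem_gaussianSpan hα (Submodule.sub_mem _ (hu m) (hu n))]
  obtain ⟨g, hg⟩ := cauchySeq_tendsto_of_complete hc'
  refine ⟨g, Lp.memLp g, (Lp.tendsto_Lp_iff_tendsto_eLpNorm'' _ hF2 g (Lp.memLp g)).1 ?_⟩
  rwa [Lp.toLp_coeFn]

/-- The Plancherel theorem for the Weinstein transform on `L¹ ∩ L²`. -/
theorem eLpNorm_transform (hα : -(1 / 2) < α) (hf₁ : Integrable f (measure d α))
    (hf₂ : MemLp f 2 (measure d α)) :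
    eLpNorm (transform α f) 2 (measure d α) = eLpNorm f 2 (measure d α) := by
  have hα' : -1 < α := by linarith
  obtain ⟨u, hu, hlim⟩ := exists_seq_gaussianSpan hα' hf₂
  obtain ⟨g, hg, hglim⟩ := exists_tendsto_transform hα hu hf₂ hlim
  have hu1 := fun n => integrable_of_mem_gaussianSpan hα' (hu n)
  have hu2 := fun n => memLp_two_of_mem_gaussianSpan hα' (hu n)
  have hF2 := fun n => memLp_two_of_mem_gaussianSpan hα' (transform_mem_gaussianSpan hα (hu n))
  have hbdd : ∀ y, ‖transform α f y‖ ≤ (∫⁻ x, ‖f x‖ₑ ∂measure d α).toReal := fun y => by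
    rw [← toReal_enorm]
    exact ENNReal.toReal_mono hf₁.2.ne (enorm_transform_le hα y)
  have hFG : ∀ (w : Fin d → ℂ) (z : ℂ), 0 < z.re →
      Integrable (fun x => transform α f x * gaussian w z x) (measure d α) := fun w z hz =>
    (integrable_gaussian hα' w hz).bdd_mul (continuous_transform hα hf₁).aestronglyMeasurable
      (ae_of_all _ hbdd)
  have hgG : ∀ (w : Fin d → ℂ) (z : ℂ), 0 < z.re →
      Integrable (fun x => g x * gaussian w z x) (measure d α) := fun w z hz =>
    hg.integrable_mul (memLp_two_gaussian hα' w hz)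
  have key : ∀ (w : Fin d → ℂ) (z : ℂ), 0 < z.re →
      ∫ x, g x * gaussian w z x ∂measure d α =
        ∫ x, transform α f x * gaussian w z x ∂measure d α := by
    intro w z hz
    have hG := gaussian_mem_gaussianSpan w hz
    have hG1 := integrable_gaussian hα' w hz
    have l1 := tendsto_integral_mul_of_tendsto_eLpNorm_sub hF2 hg (memLp_two_gaussian hα' w hz)
      hglim
    have l2 := tendsto_integral_mul_of_tendsto_eLpNorm_sub hu2 hf₂
      (memLp_two_of_mem_gaussianSpan hα' (transform_mem_gaussianSpan hα hG)) hlim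
    rw [integral_transform_mul hα hf₁ hG1]
    refine tendsto_nhds_unique l1 (l2.congr fun n => ?_)
    rw [integral_transform_mul hα (hu1 n) hG1]
  have hae : g =ᵐ[measure d α] transform α f := by
    have := ae_eq_zero_of_integral_mul_gaussian (d := d) (α := α)
      (k := fun x => g x - transform α f x)
      (((hgG 0 1 (by simp)).sub (hFG 0 1 (by simp))).congr
        (ae_of_all _ fun x => (sub_mul _ _ _).symm))
      (fun w z hz => by
        simp only [sub_mul]
        rw [integral_sub (hgG w z hz) (hFG w z hz), key w z hz, sub_self])
    filter_upwards [this] with x hx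
    exact sub_eq_zero.1 hx
  rw [← eLpNorm_congr_ae hae]
  refine tendsto_nhds_unique (tendsto_eLpNorm_of_tendsto_eLpNorm_sub hF2 hg hglim) ?_
  simp_rw [fun n => eLpNorm_transform_of_mem_gaussianSpan hα (hu n)]
  exact tendsto_eLpNorm_of_tendsto_eLpNorm_sub hu2 hf₂ hlim

end plancherel

section l2Transform

variable {d : ℕ} {α : ℝ} {φ ψ g h : Space d → ℂ}

lemma exists_isL2Transform (hα : -(1 / 2) < α) (hφ : MemLp φ 2 (measure d α)) :
    ∃ g, IsL2Transform α φ g := by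
  have hα' : -1 < α := by linarith
  obtain ⟨u, hu, hlim⟩ := exists_seq_gaussianSpan hα' hφ
  obtain ⟨g, hg, hglim⟩ := exists_tendsto_transform hα hu hφ hlim
  exact ⟨g, hg, u, fun n => ⟨memLp_one_iff_integrable.2 (integrable_of_mem_gaussianSpan hα' (hu n)),
    memLp_two_of_mem_gaussianSpan hα' (hu n)⟩, hlim, hglim⟩

lemma isL2Transform_l2Transform (hα : -(1 / 2) < α) (hφ : MemLp φ 2 (measure d α)) :
    IsL2Transform α φ (l2Transform α φ) := by
  have h := exists_isL2Transform hα hφ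
  rw [l2Transform, dif_pos h]
  exact h.choose_spec

lemma memLp_two_transform (hα : -(1 / 2) < α) (h₁ : MemLp φ 1 (measure d α))
    (h₂ : MemLp φ 2 (measure d α)) : MemLp (transform α φ) 2 (measure d α) := by
  have h₁' := memLp_one_iff_integrable.1 h₁
  exact ⟨(continuous_transform hα h₁').aestronglyMeasurable, by
    rw [eLpNorm_transform hα h₁' h₂]; exact h₂.2⟩

lemma isL2Transform_transform (hα : -(1 / 2) < α) (h₁ : MemLp φ 1 (measure d α))
    (h₂ : MemLp φ 2 (measure d α)) : IsL2Transform α φ (transform α φ) :=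
  ⟨memLp_two_transform hα h₁ h₂, fun _ => φ, fun _ => ⟨h₁, h₂⟩, by simp, by simp⟩

lemma IsL2Transform.eLpNorm_eq (hα : -(1 / 2) < α) (hφ : MemLp φ 2 (measure d α))
    (hg : IsL2Transform α φ g) : eLpNorm g 2 (measure d α) = eLpNorm φ 2 (measure d α) := by
  obtain ⟨hg2, u, hu, hlim, hglim⟩ := hg
  refine tendsto_nhds_unique (tendsto_eLpNorm_of_tendsto_eLpNorm_sub
    (fun n => memLp_two_transform hα (hu n).1 (hu n).2) hg2 hglim) ?_
  simp_rw [fun n => eLpNorm_transform hα (memLp_one_iff_integrable.1 (hu n).1) (hu n).2]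
  exact tendsto_eLpNorm_of_tendsto_eLpNorm_sub (fun n => (hu n).2) hφ hlim

lemma IsL2Transform.sub (hα : -(1 / 2) < α) (hφ : MemLp φ 2 (measure d α))
    (hψ : MemLp ψ 2 (measure d α)) (hg : IsL2Transform α φ g) (hh : IsL2Transform α ψ h) :
    IsL2Transform α (φ - ψ) (g - h) := by
  obtain ⟨hg2, u, hu, hlim, hglim⟩ := hg
  obtain ⟨hh2, v, hv, hlim', hhlim⟩ := hh
  have aux : ∀ (a b : ℕ → Space d → ℂ) (a' b' : Space d → ℂ),
      (∀ n, MemLp (a n) 2 (measure d α)) → (∀ n, MemLp (b n) 2 (measure d α)) →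
      MemLp a' 2 (measure d α) → MemLp b' 2 (measure d α) →
      Tendsto (fun n => eLpNorm (a n - a') 2 (measure d α)) atTop (𝓝 0) →
      Tendsto (fun n => eLpNorm (b n - b') 2 (measure d α)) atTop (𝓝 0) →
      Tendsto (fun n => eLpNorm (a n - b n - (a' - b')) 2 (measure d α)) atTop (𝓝 0) := by
    intro a b a' b' ha hb ha' hb' h1 h2
    have h12 := h1.add h2
    rw [add_zero] at h12
    refine tendsto_of_tendsto_of_tendsto_of_le_of_le tendsto_const_nhds h12 (fun _ => zero_le)
      fun n => ?_
    simp only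
    rw [sub_sub_sub_comm]
    exact eLpNorm_sub_le ((ha n).sub ha').1 ((hb n).sub hb').1 one_le_two
  refine ⟨hg2.sub hh2, fun n => u n - v n,
    fun n => ⟨(hu n).1.sub (hv n).1, (hu n).2.sub (hv n).2⟩,
    aux u v φ ψ (fun n => (hu n).2) (fun n => (hv n).2) hφ hψ hlim hlim', ?_⟩
  simp_rw [fun n => transform_sub hα (memLp_one_iff_integrable.1 (hu n).1)
    (memLp_one_iff_integrable.1 (hv n).1)]
  exact aux _ _ g h (fun n => memLp_two_transform hα (hu n).1 (hu n).2)
    (fun n => memLp_two_transform hα (hv n).1 (hv n).2) hg2 hh2 hglim hhlim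

lemma IsL2Transform.ae_eq (hα : -(1 / 2) < α) (hφ : MemLp φ 2 (measure d α))
    (hg : IsL2Transform α φ g) (hh : IsL2Transform α φ h) : g =ᵐ[measure d α] h := by
  have h0 := (hg.sub hα hφ hφ hh).eLpNorm_eq hα (hφ.sub hφ)
  rw [sub_self, eLpNorm_zero, eLpNorm_eq_zero_iff (hg.1.sub hh.1).1 two_ne_zero] at h0
  filter_upwards [h0] with x hx
  exact sub_eq_zero.1 hx

lemma memLp_l2Transform (hα : -(1 / 2) < α) (hφ : MemLp φ 2 (measure d α)) :
    MemLp (l2Transform α φ) 2 (measure d α) :=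
  (isL2Transform_l2Transform hα hφ).1

lemma eLpNorm_l2Transform (hα : -(1 / 2) < α) (hφ : MemLp φ 2 (measure d α)) :
    eLpNorm (l2Transform α φ) 2 (measure d α) = eLpNorm φ 2 (measure d α) :=
  (isL2Transform_l2Transform hα hφ).eLpNorm_eq hα hφ

lemma l2Transform_sub (hα : -(1 / 2) < α) (hφ : MemLp φ 2 (measure d α))
    (hψ : MemLp ψ 2 (measure d α)) :
    l2Transform α (φ - ψ) =ᵐ[measure d α] l2Transform α φ - l2Transform α ψ :=
  (isL2Transform_l2Transform hα (hφ.sub hψ)).ae_eq hα (hφ.sub hψ)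
    ((isL2Transform_l2Transform hα hφ).sub hα hφ hψ (isL2Transform_l2Transform hα hψ))

lemma ae_enorm_l2Transform_le (hα : -(1 / 2) < α) (h₁ : MemLp φ 1 (measure d α))
    (h₂ : MemLp φ 2 (measure d α)) :
    ∀ᵐ y ∂measure d α, ‖l2Transform α φ y‖ₑ ≤ eLpNorm φ 1 (measure d α) := by
  filter_upwards [(isL2Transform_l2Transform hα h₂).ae_eq hα h₂
    (isL2Transform_transform hα h₁ h₂)] with y hy
  rw [hy, eLpNorm_one_eq_lintegral_enorm]
  exact enorm_transform_le hα y

end l2Transform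

lemma eLpNorm_two_eq_lintegral {X : Type*} [MeasurableSpace X] (μ : Measure X) (f : X → ℂ) :
    eLpNorm f 2 μ = (∫⁻ x, ‖f x‖ₑ ^ 2 ∂μ) ^ (1 / 2 : ℝ) := by
  rw [eLpNorm_eq_lintegral_rpow_enorm_toReal two_ne_zero ENNReal.ofNat_ne_top]
  simp

section multiplier

variable {d : ℕ} {α : ℝ} {m φ ψ : Space d → ℂ} {σ : ℝ}

lemma lintegral_comp_smul_measure₀ (hσ : 0 < σ) {f : Space d → ℝ≥0∞}
    (hf : AEMeasurable f (measure d α)) :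
    ∫⁻ x, f (σ • x) ∂measure d α =
      ENNReal.ofReal (σ ^ (-(2 * α + d + 2))) * ∫⁻ x, f x ∂measure d α := by
  rw [lintegral_congr_ae hf.ae_eq_mk, ← lintegral_comp_smul_measure hσ hf.measurable_mk]
  exact lintegral_congr_ae ((quasiMeasurePreserving_smul hσ).ae_eq_comp hf.ae_eq_mk)

lemma memLp_two_comp_smul (hσ : 0 < σ) (hm : MemLp m 2 (measure d α)) :
    MemLp (fun x => m (σ • x)) 2 (measure d α) := by
  refine ⟨hm.1.comp_quasiMeasurePreserving (quasiMeasurePreserving_smul hσ), ?_⟩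
  have h := hm.2
  rw [eLpNorm_two_eq_lintegral, ENNReal.rpow_lt_top_iff_of_pos (by norm_num)] at h ⊢
  rw [lintegral_comp_smul_measure₀ (f := fun x => ‖m x‖ₑ ^ 2) hσ (hm.1.enorm.pow_const 2)]
  exact ENNReal.mul_lt_top ENNReal.ofReal_lt_top h

lemma integrable_comp_smul_mul_l2Transform (hα : -(1 / 2) < α) (hσ : 0 < σ)
    (hm : MemLp m 2 (measure d α)) (hφ : MemLp φ 2 (measure d α)) :
    Integrable (fun z => m (σ • z) * l2Transform α φ z) (measure d α) :=
  (memLp_two_comp_smul hσ hm).integrable_mul (memLp_l2Transform hα hφ)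

lemma multiplier_sub (hα : -(1 / 2) < α) (hσ : 0 < σ) (hm : MemLp m 2 (measure d α))
    (hφ : MemLp φ 2 (measure d α)) (hψ : MemLp ψ 2 (measure d α)) :
    multiplier α m σ (φ - ψ) = multiplier α m σ φ - multiplier α m σ ψ := by
  ext y
  simp only [multiplier, inverseTransform, Pi.sub_apply]
  rw [← Pi.sub_apply, ← transform_sub hα (integrable_comp_smul_mul_l2Transform hα hσ hm hφ)
    (integrable_comp_smul_mul_l2Transform hα hσ hm hψ)]
  refine congrFun (transform_congr_ae ?_) _
  filter_upwards [l2Transform_sub hα hφ hψ] with z hz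
  simp only [hz, Pi.sub_apply, mul_sub]

lemma enorm_multiplier_le (hα : -(1 / 2) < α) (hσ : 0 < σ) (hm : MemLp m 1 (measure d α))
    (hφ₁ : MemLp φ 1 (measure d α)) (hφ₂ : MemLp φ 2 (measure d α)) (y : Space d) :
    ‖multiplier α m σ φ y‖ₑ ≤ ENNReal.ofReal (σ ^ (-(2 * α + d + 2))) *
      eLpNorm m 1 (measure d α) * eLpNorm φ 1 (measure d α) := by
  refine (enorm_transform_le hα _).trans ?_
  calc ∫⁻ z, ‖m (σ • z) * l2Transform α φ z‖ₑ ∂measure d α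
      ≤ ∫⁻ z, ‖m (σ • z)‖ₑ * eLpNorm φ 1 (measure d α) ∂measure d α := by
        refine lintegral_mono_ae ?_
        filter_upwards [ae_enorm_l2Transform_le hα hφ₁ hφ₂] with z hz
        rw [enorm_mul]
        gcongr
    _ = _ := by
        have hmσ : AEMeasurable (fun z => ‖m (σ • z)‖ₑ) (measure d α) :=
          (hm.1.comp_quasiMeasurePreserving (quasiMeasurePreserving_smul hσ)).enorm
        rw [lintegral_mul_const'' _ hmσ,
          lintegral_comp_smul_measure₀ (f := fun x => ‖m x‖ₑ) hσ hm.1.enorm,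
          eLpNorm_one_eq_lintegral_enorm (f := m)]

lemma eLpNorm_inverseTransform (hα : -(1 / 2) < α) {f : Space d → ℂ}
    (hf₁ : Integrable f (measure d α)) (hf₂ : MemLp f 2 (measure d α)) :
    eLpNorm (inverseTransform α f) 2 (measure d α) = eLpNorm f 2 (measure d α) := by
  have hc₁ : Integrable (fun x => (starRingEnd ℂ) (f x)) (measure d α) :=
    (LinearIsometryEquiv.integrable_comp_iff Complex.conjLIE).2 hf₁
  have hc : eLpNorm (fun x => (starRingEnd ℂ) (f x)) 2 (measure d α) =
      eLpNorm f 2 (measure d α) :=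
    eLpNorm_congr_norm_ae (ae_of_all _ fun x => RCLike.norm_conj _)
  rw [← hc, ← eLpNorm_transform hα hc₁ ⟨hc₁.1, hc ▸ hf₂.2⟩]
  refine eLpNorm_congr_norm_ae (ae_of_all _ fun y => ?_)
  rw [← RCLike.norm_conj (transform α _ y), conj_transform]
  simp only [Complex.conj_conj, inverseTransform]

/-- The measure `dσ/σ` on `(0, ∞)`. -/
def dilationMeasure : Measure ℝ :=
  (volume.restrict (Ioi (0 : ℝ))).withDensity fun σ => ENNReal.ofReal (1 / σ)

instance : SigmaFinite dilationMeasure := by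
  unfold dilationMeasure; infer_instance

lemma scaleMeasure_eq_prod (d : ℕ) (α : ℝ) :
    scaleMeasure d α = dilationMeasure.prod (measure d α) := rfl

lemma ae_dilationMeasure_pos : ∀ᵐ σ ∂dilationMeasure, 0 < σ :=
  (withDensity_absolutelyContinuous _ _) (ae_restrict_mem measurableSet_Ioi)

lemma ae_scaleMeasure_pos (d : ℕ) (α : ℝ) : ∀ᵐ p ∂scaleMeasure d α, 0 < p.1 :=
  Measure.quasiMeasurePreserving_fst.ae ae_dilationMeasure_pos

lemma Admissible.lintegral_mk (hm : Admissible α m) (hmm : AEStronglyMeasurable m (measure d α)) :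
    ∀ᵐ x ∂measure d α, ∫⁻ σ, ‖hmm.mk m (σ • x)‖ₑ ^ 2 ∂dilationMeasure = 1 := by
  obtain ⟨N, hsub, hNm, hN0⟩ := exists_measurable_superset_of_null (ae_iff.1 hmm.ae_eq_mk)
  have hsmul : Measurable fun p : ℝ × Space d => p.1 • p.2 := by fun_prop
  have hmeas : MeasurableSet {p : ℝ × Space d | p.1 • p.2 ∉ N} := hsmul hNm.compl
  have h1 : ∀ᵐ σ ∂dilationMeasure, ∀ᵐ x ∂measure d α, σ • x ∉ N := by
    filter_upwards [ae_dilationMeasure_pos] with σ hσ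
    have hq : Measure.QuasiMeasurePreserving (fun x : Space d => σ • x) (measure d α)
      (measure d α) := quasiMeasurePreserving_smul hσ
    have h0 := hq.preimage_null hN0
    rw [measure_eq_zero_iff_ae_notMem] at h0
    exact h0
  have h2 := (Measure.ae_ae_comm (p := fun (σ : ℝ) (x : Space d) => σ • x ∉ N) hmeas).1 h1
  filter_upwards [hm, h2] with x hx h2x
  have hmx : Measurable fun σ : ℝ => ‖hmm.mk m (σ • x)‖ₑ ^ 2 :=
    (hmm.stronglyMeasurable_mk.measurable.comp (by fun_prop)).enorm.pow_const 2
  have hac : volume.restrict (Ioi (0 : ℝ)) ≪ dilationMeasure := by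
    refine withDensity_absolutelyContinuous' (by fun_prop) ?_
    filter_upwards [ae_restrict_mem measurableSet_Ioi] with σ hσ
    exact (ENNReal.ofReal_pos.2 (one_div_pos.2 hσ)).ne'
  rw [← hx, dilationMeasure, lintegral_withDensity_eq_lintegral_mul _ (by fun_prop) hmx]
  refine lintegral_congr_ae ?_
  filter_upwards [hac h2x] with σ hσ
  have : m (σ • x) = hmm.mk m (σ • x) := by
    by_contra hne
    exact hσ (hsub hne)
  rw [Pi.mul_apply, this, mul_comm]

lemma aestronglyMeasurable_multiplier (hα : -(1 / 2) < α) (hm : MemLp m 2 (measure d α))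
    (hφ : MemLp φ 2 (measure d α)) :
    AEStronglyMeasurable (fun p : ℝ × Space d => multiplier α m p.1 φ p.2)
      (scaleMeasure d α) := by
  have hg := (memLp_l2Transform hα hφ).1
  have hk : StronglyMeasurable fun q : (ℝ × Space d) × Space d =>
      hm.1.mk m (q.1.1 • q.2) * hg.mk _ q.2 * kernel α (reflect q.1.2) q.2 := by
    refine ((hm.1.stronglyMeasurable_mk.comp_measurable (by fun_prop)).mul
      (hg.stronglyMeasurable_mk.comp_measurable measurable_snd)).mul ?_
    have hcont : Continuous fun q : (ℝ × Space d) × Space d => (reflect q.1.2, q.2) :=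
      (continuous_reflect.comp (by fun_prop)).prodMk continuous_snd
    exact ((continuous_kernel hα).comp hcont).stronglyMeasurable
  refine ⟨_, hk.integral_prod_right' (ν := measure d α), ?_⟩
  filter_upwards [ae_scaleMeasure_pos d α] with p hp
  refine integral_congr_ae ?_
  filter_upwards [(quasiMeasurePreserving_smul hp).ae_eq_comp hm.1.ae_eq_mk, hg.ae_eq_mk]
    with z h1 h2
  simp only [Function.comp_apply] at h1
  rw [h1, h2]

/-- The Plancherel formula for the multiplier operators. -/
theorem eLpNorm_multiplier (hα : -(1 / 2) < α) (hm : MemLp m 2 (measure d α))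
    (hadm : Admissible α m) (hφ : MemLp φ 2 (measure d α)) :
    eLpNorm (fun p : ℝ × Space d => multiplier α m p.1 φ p.2) 2 (scaleMeasure d α) =
      eLpNorm φ 2 (measure d α) := by
  have hg2 := memLp_l2Transform hα hφ
  have hg := hg2.1
  set m' := hm.1.mk m
  set g := l2Transform α φ
  set g' := hg.mk g
  have hm' : Measurable m' := hm.1.stronglyMeasurable_mk.measurable
  have hg' : Measurable g' := hg.stronglyMeasurable_mk.measurable
  have hmeas : Measurable fun p : ℝ × Space d => ‖m' (p.1 • p.2)‖ₑ ^ 2 * ‖g' p.2‖ₑ ^ 2 :=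
    ((hm'.comp (by fun_prop)).enorm.pow_const 2).mul
      ((hg'.comp measurable_snd).enorm.pow_const 2)
  have htot : ∫⁻ σ, ∫⁻ z, ‖m' (σ • z)‖ₑ ^ 2 * ‖g' z‖ₑ ^ 2 ∂measure d α ∂dilationMeasure =
      ∫⁻ z, ‖g z‖ₑ ^ 2 ∂measure d α := by
    rw [lintegral_lintegral_swap hmeas.aemeasurable]
    refine lintegral_congr_ae ?_
    filter_upwards [hadm.lintegral_mk hm.1, hg.ae_eq_mk] with z h1 h2
    have : Measurable fun σ : ℝ => ‖m' (σ • z)‖ₑ ^ 2 :=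
      (hm'.comp (by fun_prop)).enorm.pow_const 2
    rw [lintegral_mul_const _ this, h1, one_mul, h2]
  have hfin : ∫⁻ z, ‖g z‖ₑ ^ 2 ∂measure d α < ∞ := by
    have := hg2.2
    rwa [eLpNorm_two_eq_lintegral, ENNReal.rpow_lt_top_iff_of_pos (by norm_num)] at this
  have hlt := ae_lt_top hmeas.lintegral_prod_right' (htot ▸ hfin).ne
  have hF : AEMeasurable (fun p : ℝ × Space d => ‖multiplier α m p.1 φ p.2‖ₑ ^ 2)
      (dilationMeasure.prod (measure d α)) :=
    (aestronglyMeasurable_multiplier hα hm hφ).enorm.pow_const 2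
  rw [← eLpNorm_l2Transform hα hφ, eLpNorm_two_eq_lintegral, eLpNorm_two_eq_lintegral, ← htot,
    scaleMeasure_eq_prod, lintegral_prod _ hF]
  congr 1
  refine lintegral_congr_ae ?_
  filter_upwards [ae_dilationMeasure_pos, hlt] with σ hσ hσlt
  have heq : ∫⁻ z, ‖m (σ • z) * g z‖ₑ ^ 2 ∂measure d α =
      ∫⁻ z, ‖m' (σ • z)‖ₑ ^ 2 * ‖g' z‖ₑ ^ 2 ∂measure d α := by
    refine lintegral_congr_ae ?_
    filter_upwards [(quasiMeasurePreserving_smul hσ).ae_eq_comp hm.1.ae_eq_mk, hg.ae_eq_mk]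
      with z h1 h2
    simp only [Function.comp_apply] at h1
    rw [h1, h2, enorm_mul, mul_pow]
  have hi := integrable_comp_smul_mul_l2Transform hα hσ hm hφ
  have h2 : MemLp (fun z => m (σ • z) * g z) 2 (measure d α) := by
    refine ⟨hi.1, ?_⟩
    rw [eLpNorm_two_eq_lintegral, ENNReal.rpow_lt_top_iff_of_pos (by norm_num), heq]
    exact hσlt
  have hP := eLpNorm_inverseTransform hα hi h2
  rw [eLpNorm_two_eq_lintegral, eLpNorm_two_eq_lintegral] at hP
  exact (ENNReal.rpow_left_injective (by norm_num : (1 / 2 : ℝ) ≠ 0) hP).trans heq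

end multiplier

lemma measurableSet_scalesAbove (d : ℕ) (a : ℝ) : MeasurableSet (scalesAbove d a) :=
  (measurableSet_le measurable_const measurable_fst).inter
    (measurable_snd (measurableSet_halfSpace d))

section uncertainty

variable {d : ℕ} {α : ℝ} {m φ : Space d → ℂ} {Ω : Set (Space d)} {S : Set (ℝ × Space d)}
  {ε ν a ρ : ℝ}

lemma eLpNorm_one_indicator_le {X : Type*} [MeasurableSpace X] {μ : Measure X} {f : X → ℂ}
    (hf : MemLp f 2 μ) {A : Set X} (hA : MeasurableSet A) :
    eLpNorm (A.indicator f) 1 μ ≤ eLpNorm f 2 μ * μ A ^ (1 / 2 : ℝ) := by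
  rw [eLpNorm_indicator_eq_eLpNorm_restrict hA]
  refine (eLpNorm_le_eLpNorm_mul_rpow_measure_univ (one_le_two) hf.1.restrict).trans ?_
  have h : 1 / ENNReal.toReal 1 - 1 / ENNReal.toReal 2 = 1 / 2 := by norm_num
  rw [Measure.restrict_apply_univ, h]
  gcongr
  exact Measure.restrict_le_self

lemma eLpNorm_indicator_multiplier_le (hα : -(1 / 2) < α) (hm : MemLp m 1 (measure d α))
    (hφ₁ : MemLp φ 1 (measure d α)) (hφ₂ : MemLp φ 2 (measure d α)) (hS : MeasurableSet S)
    (ha : 0 < a) (hSa : S ⊆ scalesAbove d a) (hρ : IsLUB (inverseScales S) ρ) :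
    eLpNorm (S.indicator fun p => multiplier α m p.1 φ p.2) 2 (scaleMeasure d α) ≤
      ENNReal.ofReal ρ ^ (2 * α + d + 2) * eLpNorm m 1 (measure d α) *
        eLpNorm φ 1 (measure d α) * scaleMeasure d α S ^ (1 / 2 : ℝ) := by
  rw [eLpNorm_indicator_eq_eLpNorm_restrict hS]
  have hd : (0 : ℝ) ≤ d := Nat.cast_nonneg d
  have hbound : ∀ᵐ p ∂(scaleMeasure d α).restrict S, ‖multiplier α m p.1 φ p.2‖ₑ ≤
      ENNReal.ofReal ρ ^ (2 * α + d + 2) * eLpNorm m 1 (measure d α) *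
        eLpNorm φ 1 (measure d α) := by
    filter_upwards [ae_restrict_mem hS] with p hp
    have hσ : 0 < p.1 := ha.trans_le (hSa hp).1
    refine (enorm_multiplier_le hα hσ hm hφ₁ hφ₂ p.2).trans ?_
    gcongr
    have hle : 1 / p.1 ≤ ρ := hρ.1 ⟨p.1, p.2, hp, rfl⟩
    rw [Real.rpow_neg hσ.le, ← Real.inv_rpow hσ.le, ← one_div,
      ← ENNReal.ofReal_rpow_of_pos (one_div_pos.2 hσ)]
    exact ENNReal.rpow_le_rpow (ENNReal.ofReal_le_ofReal hle) (by linarith)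
  refine (eLpNorm_le_of_ae_enorm_bound hbound).trans (le_of_eq ?_)
  rw [Measure.restrict_apply_univ, smul_eq_mul, ENNReal.toReal_ofNat, one_div]

/-- The norm of `φ` is controlled by the two concentration defects and by the norm of the
multiplier applied to the part of `φ` in `Ω`, restricted to `S`. -/
lemma eLpNorm_le_add_add (hα : -(1 / 2) < α) (hm₂ : MemLp m 2 (measure d α))
    (hm : Admissible α m) (hφ : MemLp φ 2 (measure d α)) (hΩ : MeasurableSet Ω)
    (hS : MeasurableSet S) :
    eLpNorm φ 2 (measure d α) ≤
      eLpNorm ((fun p => multiplier α m p.1 φ p.2) -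
        S.indicator fun p => multiplier α m p.1 φ p.2) 2 (scaleMeasure d α) +
      eLpNorm (φ - Ω.indicator φ) 2 (measure d α) +
      eLpNorm (S.indicator fun p => multiplier α m p.1 (Ω.indicator φ) p.2) 2
        (scaleMeasure d α) := by
  have hψ : MemLp (Ω.indicator φ) 2 (measure d α) := hφ.indicator hΩ
  have hF := aestronglyMeasurable_multiplier hα hm₂ hφ
  have hF₁ := aestronglyMeasurable_multiplier hα hm₂ (hφ.sub hψ)
  have hF₂ := aestronglyMeasurable_multiplier hα hm₂ hψ
  rw [← eLpNorm_multiplier hα hm₂ hm hφ, ← eLpNorm_multiplier hα hm₂ hm (hφ.sub hψ)]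
  set F := fun p : ℝ × Space d => multiplier α m p.1 φ p.2
  set F₁ := fun p : ℝ × Space d => multiplier α m p.1 (φ - Ω.indicator φ) p.2
  set F₂ := fun p : ℝ × Space d => multiplier α m p.1 (Ω.indicator φ) p.2
  have hsplit : F =ᵐ[scaleMeasure d α] (F - S.indicator F) + S.indicator F₁ + S.indicator F₂ := by
    filter_upwards [ae_scaleMeasure_pos d α] with p hp
    have h := congrFun (multiplier_sub hα hp hm₂ hφ hψ) p.2
    by_cases hpS : p ∈ S
    · simp only [Pi.add_apply, Pi.sub_apply, indicator_of_mem hpS, F, F₁, F₂, h]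
      ring
    · simp [indicator_of_notMem hpS]
  calc eLpNorm F 2 (scaleMeasure d α)
      = eLpNorm ((F - S.indicator F) + S.indicator F₁ + S.indicator F₂) 2 (scaleMeasure d α) :=
        eLpNorm_congr_ae hsplit
    _ ≤ eLpNorm (F - S.indicator F) 2 (scaleMeasure d α) +
        eLpNorm (S.indicator F₁) 2 (scaleMeasure d α) +
        eLpNorm (S.indicator F₂) 2 (scaleMeasure d α) := by
        refine (eLpNorm_add_le ((hF.sub (hF.indicator hS)).add (hF₁.indicator hS))
          (hF₂.indicator hS) one_le_two).trans ?_
        gcongr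
        exact eLpNorm_add_le (hF.sub (hF.indicator hS)) (hF₁.indicator hS) one_le_two
    _ ≤ _ := by
        gcongr
        exact eLpNorm_indicator_le _

theorem uncertainty (hα : -(1 / 2) < α)
    (hm₁ : MemLp m 1 (measure d α)) (hm₂ : MemLp m 2 (measure d α)) (hm : Admissible α m)
    (hφ : MemLp φ 2 (measure d α)) (hφ₀ : ¬ φ =ᵐ[measure d α] 0) (hΩ : MeasurableSet Ω)
    (ha : 0 < a) (hε : Concentrated (measure d α) φ Ω ε) (hS : MeasurableSet S)
    (hSa : S ⊆ scalesAbove d a) (hρ : IsLUB (inverseScales S) ρ)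
    (hν : Concentrated (scaleMeasure d α) (fun p => multiplier α m p.1 φ p.2) S ν) :
    ENNReal.ofReal (1 - (ε + ν)) ≤
      ENNReal.ofReal ρ ^ (2 * α + d + 2) * eLpNorm m 1 (measure d α) *
        measure d α Ω ^ (1 / 2 : ℝ) * scaleMeasure d α S ^ (1 / 2 : ℝ) := by
  set B := ENNReal.ofReal ρ ^ (2 * α + d + 2) * eLpNorm m 1 (measure d α) *
        measure d α Ω ^ (1 / 2 : ℝ) * scaleMeasure d α S ^ (1 / 2 : ℝ) with hB
  have hd : (0 : ℝ) ≤ d := Nat.cast_nonneg d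
  rcases eq_or_ne B ∞ with hBt | hBt
  · rw [hBt]; exact le_top
  set N := eLpNorm φ 2 (measure d α) with hN
  have hNtop : N ≠ ∞ := hφ.2.ne
  have hN0 : N ≠ 0 := fun h => hφ₀ ((eLpNorm_eq_zero_iff hφ.1 two_ne_zero).1 h)
  have hψ : MemLp (Ω.indicator φ) 2 (measure d α) := hφ.indicator hΩ
  have hiso := eLpNorm_multiplier hα hm₂ hm hφ
  have hρ0 : 0 < ρ := by
    obtain ⟨r, hr⟩ := hρ.nonempty
    have hrρ := hρ.1 hr
    obtain ⟨σ, x, hx, rfl⟩ := hr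
    exact (one_div_pos.2 (ha.trans_le (hSa hx).1)).trans_le hrρ
  have hm0 : eLpNorm m 1 (measure d α) ≠ 0 := by
    intro h0
    refine hN0 ?_
    rw [hN, ← hiso, eLpNorm_eq_zero_iff (aestronglyMeasurable_multiplier hα hm₂ hφ) two_ne_zero]
    filter_upwards [ae_scaleMeasure_pos d α] with p hp
    have hmz := (quasiMeasurePreserving_smul hp).ae
      ((eLpNorm_eq_zero_iff hm₁.1 one_ne_zero).1 h0)
    refine integral_eq_zero_of_ae ?_
    filter_upwards [hmz] with z hz
    simp [hz]
  have hlast : eLpNorm (S.indicator fun p => multiplier α m p.1 (Ω.indicator φ) p.2) 2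
      (scaleMeasure d α) ≤ B * N := by
    rcases eq_or_ne (scaleMeasure d α S) 0 with hS0 | hS0
    · rw [eLpNorm_indicator_eq_eLpNorm_restrict hS, Measure.restrict_eq_zero.2 hS0]
      simp
    have hΩt : measure d α Ω ≠ ∞ := by
      intro h
      refine hBt ?_
      rw [hB, h, ENNReal.top_rpow_of_pos (by norm_num), ENNReal.mul_top, ENNReal.top_mul]
      · simp [hS0]
      · refine mul_ne_zero ?_ hm0
        rw [ENNReal.ofReal_rpow_of_pos hρ0]
        exact (ENNReal.ofReal_pos.2 (Real.rpow_pos_of_pos hρ0 _)).ne'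
    have hle := eLpNorm_one_indicator_le hφ hΩ
    have hψ₁ : MemLp (Ω.indicator φ) 1 (measure d α) :=
      ⟨hψ.1, hle.trans_lt (ENNReal.mul_lt_top hφ.2
        (ENNReal.rpow_lt_top_of_nonneg (by norm_num) hΩt))⟩
    refine (eLpNorm_indicator_multiplier_le hα hm₁ hψ₁ hψ hS ha hSa hρ).trans ?_
    calc _ ≤ ENNReal.ofReal ρ ^ (2 * α + d + 2) * eLpNorm m 1 (measure d α) *
          (N * measure d α Ω ^ (1 / 2 : ℝ)) * scaleMeasure d α S ^ (1 / 2 : ℝ) := by gcongr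
      _ = B * N := by rw [hB]; ring
  have hmain := eLpNorm_le_add_add hα hm₂ hm hφ hΩ hS
  rw [Concentrated, hiso] at hν
  rw [Concentrated] at hε
  have hF : MemLp (fun p : ℝ × Space d => multiplier α m p.1 φ p.2) 2 (scaleMeasure d α) :=
    ⟨aestronglyMeasurable_multiplier hα hm₂ hφ, by rw [hiso]; exact hφ.2⟩
  have h1 := (hF.sub (hF.indicator hS)).2.ne
  have h2 := (hφ.sub hψ).2.ne
  have hBN := ENNReal.mul_ne_top hBt hNtop
  have hreal := ENNReal.toReal_mono (ENNReal.add_ne_top.2 ⟨ENNReal.add_ne_top.2 ⟨h1, h2⟩, hBN⟩)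
    (hmain.trans (add_le_add le_rfl hlast))
  rw [ENNReal.toReal_add (ENNReal.add_ne_top.2 ⟨h1, h2⟩) hBN, ENNReal.toReal_add h1 h2,
    ENNReal.toReal_mul] at hreal
  have hNpos : 0 < N.toReal := ENNReal.toReal_pos hN0 hNtop
  refine ENNReal.ofReal_le_of_le_toReal ?_
  nlinarith [hreal, hν, hε]

end uncertainty
end Weinstein

end

theorem corollary4p4 {d : ℕ} {α : ℝ} (hα : -(1 / 2) < α)
    {m φ : Weinstein.Space d → ℂ}
    (hm₁ : MemLp m 1 (Weinstein.measure d α)) (hm₂ : MemLp m 2 (Weinstein.measure d α))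
    (hm : Weinstein.Admissible α m)
    (hφ : MemLp φ 2 (Weinstein.measure d α)) (hφ₀ : ¬ φ =ᵐ[Weinstein.measure d α] 0)
    {Ω : Set (Weinstein.Space d)} (hΩ : MeasurableSet Ω) (hΩ' : Ω ⊆ Weinstein.halfSpace d)
    {ε ν a ρ : ℝ} (ha : 0 < a)
    (hε : Weinstein.Concentrated (Weinstein.measure d α) φ Ω ε) :
    (∀ S : Set (ℝ × Weinstein.Space d), S = Weinstein.scalesAbove d a →
      IsGreatest (Weinstein.inverseScales S) ρ →
      Weinstein.Concentrated (Weinstein.scaleMeasure d α)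
        (fun p => Weinstein.multiplier α m p.1 φ p.2) S ν →
      ENNReal.ofReal (1 - (ε + ν)) ≤
        ENNReal.ofReal ρ ^ (2 * α + d + 2) * eLpNorm m 1 (Weinstein.measure d α) *
          Weinstein.measure d α Ω ^ (1 / 2 : ℝ) * Weinstein.scaleMeasure d α S ^ (1 / 2 : ℝ)) ∧
    (∀ S : Set (ℝ × Weinstein.Space d), MeasurableSet S → S ⊆ Weinstein.scalesAbove d a →
      IsLUB (Weinstein.inverseScales S) ρ →
      Weinstein.Concentrated (Weinstein.scaleMeasure d α)
        (fun p => Weinstein.multiplier α m p.1 φ p.2) S ν →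
      ENNReal.ofReal (1 - (ε + ν)) ≤
        ENNReal.ofReal ρ ^ (2 * α + d + 2) * eLpNorm m 1 (Weinstein.measure d α) *
          Weinstein.measure d α Ω ^ (1 / 2 : ℝ) * Weinstein.scaleMeasure d α S ^ (1 / 2 : ℝ)) := by
  refine ⟨fun S hS hρ hν => ?_, fun S hS hSa hρ hν => ?_⟩
  · exact Weinstein.uncertainty hα hm₁ hm₂ hm hφ hφ₀ hΩ ha hε
      (hS ▸ Weinstein.measurableSet_scalesAbove d a) hS.subset hρ.isLUB hν
  · exact Weinstein.uncertainty hα hm₁ hm₂ hm hφ hφ₀ hΩ ha hε hS hSa hρ hν
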